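/- Let $d\ge 3$. Let $L^2_{\mathrm{rad}}(\mathbb{R}^d)$ denote the spherically symmetric functions in $L^2(\mathbb{R}^d)$, let $\hat f(\xi)=(2\pi)^{-d/2}\int_{\mathbb{R}^d}e^{-ix\cdot\xi}f(x)\,dx$ be the unitary Fourier transform (extended to $L^2$), and write radial functions in terms of the radial variable. For $f\in L^2_{\mathrm{rad}}(\mathbb{R}^d)$ and $0<a<b<\infty$ put, with $r=|x|$, $$[P^{+}_{a,b}f](r)=\tfrac12\int_a^b r^{\frac{2-d}{2}}H^{(1)}_{\frac{d-2}{2}}(kr)\,\hat f(k)\,k^{\frac d2}\,dk,\qquad [P^{-}_{a,b}f](r)=\tfrac12\int_a^b r^{\frac{2-d}{2}}H^{(2)}_{\frac{d-2}{2}}(kr)\,\hat f(k)\,k^{\frac d2}\,dk,$$ where $H^{(1)}_\nu=J_\nu+iY_\nu$ and $H^{(2)}_\nu=J_\nu-iY_\nu$ are the Hankel functions. The projections onto outgoing and incoming waves are $$P^{\pm}f=\tfrac12\int_0^\infty r^{\frac{2-d}{2}}H^{(1),(2)}_{\frac{d-2}{2}}(kr)\,\hat f(k)\,k^{\frac d2}\,dk:=\lim_{a\to0^+,\,b\to\infty}P^{\pm}_{a,b}f,$$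 the limit being taken in $L^2(\{\delta\le|x|\le R\})$ for every $0<\delta<R<\infty$; $P^\pm f$ is said to be defined if this limit exists. Let $\varphi\in C^\infty(\mathbb{R}^d;\mathbb{R})$ be radial, supported in $\{|\xi|\le\frac{11}{10}\}$ and equal to $1$ on $\{|\xi|\le1\}$. For $N>0$ let $P_{>N}$ and $P_{\ge N}$ be the Fourier multipliers on $L^2(\mathbb{R}^d)$ with symbols $1-\varphi(\xi/N)$ and $1-\varphi(2\xi/N)$, respectively. (i) $P^++P^-$ acts as the identity on $L^2_{\mathrm{rad}}(\mathbb{R}^d)$. That is, for every $f\in L^2_{\mathrm{rad}}(\mathbb{R}^d)$, $P^+_{a,b}f+P^-_{a,b}f\to f$ in $L^2(\mathbb{R}^d)$ as $a\to0^+$, $b\to\infty$; moreover $P^+f$ is defined if and only if $P^-f$ is, and in that case $P^+f+P^-f=f$ almost everywhere. The $f$ for which $P^\pm f$ are defined are dense in $L^2_{\mathrm{rad}}(\mathbb{R}^d)$, and for $d=3$ they are all of $L^2_{\mathrm{rad}}(\mathbb{R}^d)$. (ii) There is a constant $C$, depending only on $d$ and $\varphi$, such that for every $N>0$ and every $f\in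 L^2_{\mathrm{rad}}(\mathbb{R}^d)$ the functions $P^\pm P_{\ge N}f$ are defined and $$\bigl\|P^\pm P_{\ge N}f\bigr\|_{L^2(|x|\ge\frac1{100}N^{-1})}\le C\,\|f\|_{L^2(\mathbb{R}^d)},$$ and the same holds with $P_{>N}$ in place of $P_{\ge N}$. -/

import Mathlib

open MeasureTheory Filter Topology Set
open scoped FourierTransform ENNReal NNReal ContDiff

noncomputable section

namespace InOut

/-- Euclidean space `ℝ^d`. -/
abbrev Rd (d : ℕ) : Type := EuclideanSpace ℝ (Fin d)

/-- The complex Hilbert space `L²(ℝ^d)`. -/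
abbrev L2 (d : ℕ) : Type := Lp (α := Rd d) ℂ 2 volume

/-- `f ∈ L²_rad(ℝ^d)`: the function `f` is spherically symmetric, `f(x) = g(|x|)` almost everywhere. -/
def IsRadial {d : ℕ} (f : L2 d) : Prop :=
  ∃ g : ℝ → ℂ, Measurable g ∧ f =ᵐ[volume] fun x : Rd d => g ‖x‖

/-- The Bessel function `J_ν(x)`, for `x > 0` and `ν > -1/2`, by Poisson's integral
`J_ν(x) = 2 (x/2)^ν / (√π Γ(ν+1/2)) ∫₀¹ (1-t²)^(ν-1/2) cos(xt) dt`. -/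
def besselJ (ν x : ℝ) : ℝ :=
  2 * (x / 2) ^ ν / (√Real.pi * Real.Gamma (ν + 1 / 2)) *
    ∫ t in (0 : ℝ)..1, (1 - t ^ 2) ^ (ν - 1 / 2) * Real.cos (x * t)

/-- The Bessel function of the second kind `Y_ν(x)`, for `x > 0` and `ν > -1/2`, by the companion
of Poisson's integral, `Y_ν(x) = 2 (x/2)^ν / (√π Γ(ν+1/2)) *
(∫₀¹ (1-t²)^(ν-1/2) sin(xt) dt - ∫₀^∞ (1+t²)^(ν-1/2) e^(-xt) dt)`. -/
def besselY (ν x : ℝ) : ℝ :=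
  2 * (x / 2) ^ ν / (√Real.pi * Real.Gamma (ν + 1 / 2)) *
    ((∫ t in (0 : ℝ)..1, (1 - t ^ 2) ^ (ν - 1 / 2) * Real.sin (x * t)) -
      ∫ t in Ioi (0 : ℝ), (1 + t ^ 2) ^ (ν - 1 / 2) * Real.exp (-(x * t)))

/-- The Hankel function `H^{(1)}_ν = J_ν + i Y_ν`. -/
def hankelOne (ν x : ℝ) : ℂ := (besselJ ν x : ℂ) + Complex.I * (besselY ν x : ℂ)

/-- The Hankel function `H^{(2)}_ν = J_ν - i Y_ν`. -/
def hankelTwo (ν x : ℝ) : ℂ := (besselJ ν x : ℂ) - Complex.I * (besselY ν x : ℂ)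

/-- The unitary Fourier transform `f̂(ξ) = (2π)^(-d/2) ∫ e^(-i x·ξ) f(x) dx` on `L²(ℝ^d)`, obtained
by rescaling Mathlib's transform, whose phase is `e^(-2πi x·ζ)`. -/
def fhat {d : ℕ} (f : L2 d) (ξ : Rd d) : ℂ :=
  (((2 * Real.pi) ^ (-((d : ℝ) / 2)) : ℝ) : ℂ) * (𝓕 f : L2 d) ((2 * Real.pi)⁻¹ • ξ)

/-- A function on `ℝ^d` in terms of the radial variable `k > 0`: its average over the sphere
`|ξ| = k` with respect to surface measure. If `F(ξ) = F₀(|ξ|)` for almost every `ξ`, this equals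
`F₀(k)` for almost every `k > 0`. -/
def radialPart {d : ℕ} (F : Rd d → ℂ) (k : ℝ) : ℂ :=
  ⨍ s : Metric.sphere (0 : Rd d) 1, F (k • (s : Rd d)) ∂((volume : Measure (Rd d)).toSphere)

/-- The contribution of the frequencies `a < k < b` to a superposition of spherical waves:
`½ ∫_a^b r^((2-d)/2) H_{(d-2)/2}(k r) f̂(k) k^(d/2) dk`, with `r = |x|`. -/
def waveTrunc {d : ℕ} (H : ℝ → ℝ → ℂ) (a b : ℝ) (f : L2 d) (x : Rd d) : ℂ :=
  (1 / 2 : ℂ) * ∫ k in a..b,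
    ((‖x‖ ^ ((2 - (d : ℝ)) / 2) : ℝ) : ℂ) * H (((d : ℝ) - 2) / 2) (k * ‖x‖) *
      radialPart (fhat f) k * ((k ^ ((d : ℝ) / 2) : ℝ) : ℂ)

/-- `u(r) = ½ ∫_0^∞ r^((2-d)/2) H_{(d-2)/2}(k r) f̂(k) k^(d/2) dk`, where the integral is the limit
of the integrals over `(a, b)` as `a → 0` and `b → ∞`, in `L²` on each annulus
`δ ≤ |x| ≤ R`, `0 < δ < R`, that is, in `L²_loc(ℝ^d ∖ {0})`. -/
def IsWaveProj {d : ℕ} (H : ℝ → ℝ → ℂ) (f : L2 d) (u : Rd d → ℂ) : Prop :=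
  AEStronglyMeasurable u volume ∧
    ∀ δ R : ℝ, 0 < δ → δ < R →
      Tendsto (fun p : ℝ × ℝ => eLpNorm (fun x => waveTrunc H p.1 p.2 f x - u x) 2
          (volume.restrict {x : Rd d | δ ≤ ‖x‖ ∧ ‖x‖ ≤ R}))
        (𝓝[>] (0 : ℝ) ×ˢ atTop) (𝓝 0)

/-- `P⁺ f` is defined and equal to `u`: projection onto outgoing spherical waves. -/
def IsOutgoing {d : ℕ} (f : L2 d) (u : Rd d → ℂ) : Prop := IsWaveProj hankelOne f u

/-- `P⁻ f` is defined and equal to `u`: projection onto incoming spherical waves. -/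
def IsIncoming {d : ℕ} (f : L2 d) (u : Rd d → ℂ) : Prop := IsWaveProj hankelTwo f u

/-- The Littlewood-Paley cutoffs: smooth radial functions supported in `|ξ| ≤ 11/10` and equal to
`1` on `|ξ| ≤ 1`. -/
structure LPCutoff (d : ℕ) where
  /-- the underlying function -/
  φ : Rd d → ℝ
  smooth : ContDiff ℝ ∞ φ
  radial : ∀ x y : Rd d, ‖x‖ = ‖y‖ → φ x = φ y
  support_subset : Function.support φ ⊆ Metric.closedBall 0 (11 / 10)
  eq_one : ∀ x : Rd d, ‖x‖ ≤ 1 → φ x = 1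

theorem LPCutoff.memLp_mul {d : ℕ} (Φ : LPCutoff d) (c : ℝ) (g : L2 d) :
    MemLp (fun ζ : Rd d => ((1 - Φ.φ (c • ζ) : ℝ) : ℂ) * g ζ) 2 volume := by
  have hc : HasCompactSupport Φ.φ :=
    HasCompactSupport.intro (isCompact_closedBall (0 : Rd d) (11 / 10)) (fun x hx => by
      by_contra h
      exact hx (Φ.support_subset h))
  obtain ⟨C, hC⟩ := Φ.smooth.continuous.bounded_above_of_compact_support hc
  refine MemLp.of_le_mul (c := 1 + C) (Lp.memLp g) ?_ (Eventually.of_forall fun ζ => ?_)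
  · refine AEStronglyMeasurable.mul ?_ (Lp.aestronglyMeasurable g)
    have := Φ.smooth.continuous
    exact Continuous.aestronglyMeasurable (by fun_prop)
  · rw [norm_mul, Complex.norm_real]
    gcongr
    calc ‖1 - Φ.φ (c • ζ)‖ ≤ ‖(1 : ℝ)‖ + ‖Φ.φ (c • ζ)‖ := norm_sub_le _ _
      _ ≤ 1 + C := by
        rw [norm_one]
        gcongr
        exact hC _

/-- The Littlewood-Paley operator `P_{>N}` on `L²(ℝ^d)`: the Fourier multiplier with symbol
`1 - φ(ξ/N)`. Here `ξ = 2π ζ`, where `ζ` is the variable of Mathlib's Fourier transform. -/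
def LPgt {d : ℕ} (Φ : LPCutoff d) (N : ℝ) (f : L2 d) : L2 d :=
  𝓕⁻ ((Φ.memLp_mul (2 * Real.pi / N) (𝓕 f : L2 d)).toLp _ : L2 d)

/-- The Littlewood-Paley operator `P_{≥N} = P_{>N} + P_N` on `L²(ℝ^d)`: the symbol of `P_N` is
`φ(ξ/N) - φ(2ξ/N)`, so that of `P_{≥N}` is `1 - φ(2ξ/N)`. -/
def LPge {d : ℕ} (Φ : LPCutoff d) (N : ℝ) (f : L2 d) : L2 d := LPgt Φ (N / 2) f

end InOut

end

/-! Everything reduces to one dimension. For radial `f` put `g(k) = k^((d-1)/2) f̂(k)` on `k > 0`;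
up to a constant factor `f ↦ g` preserves `L²` norms. The wave integrals become `r^((d-1)/2)
P^±_{a,b} f (r) = ½ ∫_a^b κ(kr) g(k) dk` with `κ(z) = √z H(z)`, a kernel depending on the product
`kr` only.

The kernel splits as `κ(z) = A e^{±iz} + E(z)`, where `E(z) = O(1/z)` on every half-line `z ≥ c >
0`. The exponential gives a Fourier transform on the line, bounded on `L²` by Plancherel. If `g`
lives on `k ≥ α` and only `r ≥ δ` is considered, then `|E(kr)| ≤ M/(kr)`, and Cauchy-Schwarz in `k`
followed by the `L²` norm of `1/r` bounds the remainder by `M (αδ)^(-1/2)` times the norm of `g`.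
The same bound applied to the discarded frequencies gives convergence of the truncations
(`exists_isWaveProj`). Hence `P^± f` exist whenever `f̂` vanishes near the origin, and such `f` are
dense. For `P_{≥N}` and `P_{>N}` one may take `α = N/2`, `δ = 1/(100 N)`; then `αδ = 1/200`, so the
bound does not depend on `N`. In dimension three `ν = 1/2`, `E` vanishes identically on `z > 0`, and
no restriction on `f` remains.

The asymptotics come from a contour shift: Poisson's integrals combine into `H^{(1)}_ν` as a Laplace
integral along `1 + i[0, ∞)` (`hankelOne_eq`). Freezing its slowly varying factor at the endpoint
gives the exponential, and the error gains a factor `1/x` (`hankelOne_asymptotic`).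

For the sum, `H^{(1)} + H^{(2)} = 2J`, and `J_{(d-2)/2}` is the Fourier transform of surface measure
on the sphere (`sphere_integral_exp`). So `P⁺_{a,b} f + P⁻_{a,b} f` is the inverse Fourier transform
of `f̂` cut off to `a < |ξ| ≤ b`, which tends to `f` in `L²`. Convergence of one summand then forces
convergence of the other. -/

noncomputable section

namespace InOut

/-! ### The `L²` Fourier transform on integrable functions. -/

section Fourier

variable {V : Type*} [NormedAddCommGroup V] [InnerProductSpace ℝ V] [FiniteDimensional ℝ V]
  [MeasurableSpace V] [BorelSpace V]

/-- On `L¹ ∩ L²` the `L²` Fourier transform is given by the Fourier integral. -/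
theorem fourier_Lp_ae_eq (f : Lp (α := V) ℂ 2 volume) (hf : Integrable (f : V → ℂ)) :
    ((𝓕 f : Lp (α := V) ℂ 2 volume) : V → ℂ) =ᵐ[volume] 𝓕 (f : V → ℂ) := by
  have hcont : Continuous (𝓕 (f : V → ℂ)) :=
    VectorFourier.fourierIntegral_continuous Real.continuous_fourierChar
      (by exact continuous_inner) hf
  refine ae_eq_of_integral_contDiff_smul_eq
    ((Lp.memLp (𝓕 f)).locallyIntegrable (by norm_num)) hcont.locallyIntegrable ?_
  intro g g_smooth g_cpt
  have hg₁ : HasCompactSupport (Complex.ofRealCLM ∘ g) := g_cpt.comp_left rfl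
  have hg₂ : ContDiff ℝ ∞ (Complex.ofRealCLM ∘ g) := by fun_prop
  set G : SchwartzMap V ℂ := hg₁.toSchwartzMap hg₂ with hG
  have hGg : ∀ x, G x = (g x : ℂ) := fun x => by simp [hG]
  -- Both transforms are tested against smooth compactly supported `g`: the tempered transform is
  -- defined by this duality, and the integral transform satisfies it by Fubini.
  have h1 : ∫ x, G x • (𝓕 f : Lp (α := V) ℂ 2 volume) x = ∫ x, (𝓕 G) x • f x := by
    rw [← Lp.toTemperedDistribution_apply, ← Lp.fourier_toTemperedDistribution_eq,
      TemperedDistribution.fourier_apply, Lp.toTemperedDistribution_apply]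
  have h2 : ∫ x, (𝓕 G) x • f x = ∫ x, G x • 𝓕 (f : V → ℂ) x := by
    rw [SchwartzMap.fourier_coe]
    have := VectorFourier.integral_fourierIntegral_smul_eq_flip (μ := volume) (ν := volume)
      (L := innerₗ V) Real.continuous_fourierChar (by exact continuous_inner) G.integrable hf
    rw [flip_innerₗ] at this
    exact this
  calc ∫ x, g x • (𝓕 f : Lp (α := V) ℂ 2 volume) x
      = ∫ x, G x • (𝓕 f : Lp (α := V) ℂ 2 volume) x := by
        simp_rw [hGg]; rfl
    _ = ∫ x, G x • 𝓕 (f : V → ℂ) x := h1.trans h2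
    _ = _ := by simp_rw [hGg]; rfl

/-- On `L¹ ∩ L²` the inverse `L²` Fourier transform is given by the inverse Fourier integral. -/
theorem fourierInv_Lp_ae_eq (f : Lp (α := V) ℂ 2 volume) (hf : Integrable (f : V → ℂ)) :
    ((𝓕⁻ f : Lp (α := V) ℂ 2 volume) : V → ℂ) =ᵐ[volume] 𝓕⁻ (f : V → ℂ) := by
  have hcont : Continuous (𝓕⁻ (f : V → ℂ)) := by
    have : Continuous (𝓕 (f : V → ℂ)) :=
      VectorFourier.fourierIntegral_continuous Real.continuous_fourierChar
        (by exact continuous_inner) hf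
    have h2 : 𝓕⁻ (f : V → ℂ) = fun x => 𝓕 (f : V → ℂ) (-x) := by
      ext x; exact Real.fourierInv_eq_fourier_neg _ _
    rw [h2]; exact this.comp continuous_neg
  refine ae_eq_of_integral_contDiff_smul_eq
    ((Lp.memLp (𝓕⁻ f)).locallyIntegrable (by norm_num)) hcont.locallyIntegrable ?_
  intro g g_smooth g_cpt
  have hg₁ : HasCompactSupport (Complex.ofRealCLM ∘ g) := g_cpt.comp_left rfl
  have hg₂ : ContDiff ℝ ∞ (Complex.ofRealCLM ∘ g) := by fun_prop
  set G : SchwartzMap V ℂ := hg₁.toSchwartzMap hg₂ with hG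
  have hGg : ∀ x, G x = (g x : ℂ) := fun x => by simp [hG]
  have h1 : ∫ x, G x • (𝓕⁻ f : Lp (α := V) ℂ 2 volume) x = ∫ x, (𝓕⁻ G) x • f x := by
    rw [← Lp.toTemperedDistribution_apply, ← Lp.fourierInv_toTemperedDistribution_eq,
      TemperedDistribution.fourierInv_apply, Lp.toTemperedDistribution_apply]
  have h2 : ∫ x, (𝓕⁻ G) x • f x = ∫ x, G x • 𝓕⁻ (f : V → ℂ) x := by
    rw [SchwartzMap.fourierInv_coe]
    have := VectorFourier.integral_fourierIntegral_smul_eq_flip (μ := volume) (ν := volume)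
      (L := -innerₗ V) Real.continuous_fourierChar
      (by exact continuous_inner.neg) G.integrable hf
    have hfl : (-innerₗ V).flip = -innerₗ V := by
      ext x y; simp [real_inner_comm]
    rw [hfl] at this
    exact this
  calc ∫ x, g x • (𝓕⁻ f : Lp (α := V) ℂ 2 volume) x
      = ∫ x, G x • (𝓕⁻ f : Lp (α := V) ℂ 2 volume) x := by
        simp_rw [hGg]; rfl
    _ = ∫ x, G x • 𝓕⁻ (f : V → ℂ) x := h1.trans h2
    _ = _ := by simp_rw [hGg]; rfl

end Fourier

/-! ### Polar coordinates. -/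

section Polar

variable {E : Type*} [NormedAddCommGroup E] [NormedSpace ℝ E] [MeasurableSpace E] [BorelSpace E]
  [FiniteDimensional ℝ E] [Nontrivial E] (μ : Measure E) [μ.IsAddHaarMeasure]

/-- Off the null point `0` the space is, measure-theoretically, the product of the sphere and the
half-line with density `r^(n-1)`, so Tonelli applies. -/
theorem lintegral_polar {G : E → ℝ≥0∞} (hG : Measurable G) :
    ∫⁻ x, G x ∂μ = ∫⁻ r in Ioi (0 : ℝ), ENNReal.ofReal (r ^ (Module.finrank ℝ E - 1)) *
      ∫⁻ θ, G (r • (θ : E)) ∂μ.toSphere := by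
  have hm : Measurable fun p : Metric.sphere (0 : E) 1 × Ioi (0 : ℝ) =>
      G ((p.2 : ℝ) • (p.1 : E)) := hG.comp (by fun_prop)
  have hm2 : Measurable fun r : Ioi (0 : ℝ) => ∫⁻ θ, G ((r : ℝ) • (θ : E)) ∂μ.toSphere :=
    Measurable.lintegral_prod_left' hm
  calc ∫⁻ x, G x ∂μ = ∫⁻ x : ({(0)}ᶜ : Set E), G x ∂(μ.comap (↑)) := by
        rw [lintegral_subtype_comap (measurableSet_singleton _).compl, restrict_compl_singleton]
    _ = ∫⁻ p, G ((p.2 : ℝ) • (p.1 : E)) ∂(μ.toSphere.prod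
          (Measure.volumeIoiPow (Module.finrank ℝ E - 1))) := by
        rw [← μ.measurePreserving_homeomorphUnitSphereProd.lintegral_comp hm]
        refine lintegral_congr fun x => ?_
        congr 1
        have hx : ‖(x : E)‖ ≠ 0 := norm_ne_zero_iff.2 x.2
        simp [smul_smul, hx]
    _ = ∫⁻ r, ∫⁻ θ, G ((r : ℝ) • (θ : E)) ∂μ.toSphere
          ∂(Measure.volumeIoiPow (Module.finrank ℝ E - 1)) := lintegral_prod_symm' _ hm
    _ = ∫⁻ r : Ioi (0 : ℝ), ENNReal.ofReal ((r : ℝ) ^ (Module.finrank ℝ E - 1)) *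
          ∫⁻ θ, G ((r : ℝ) • (θ : E)) ∂μ.toSphere ∂(Measure.comap Subtype.val volume) := by
        rw [Measure.volumeIoiPow, lintegral_withDensity_eq_lintegral_mul _ (by fun_prop) hm2]
        rfl
    _ = _ := by
        rw [lintegral_subtype_comap measurableSet_Ioi
          (fun r : ℝ => ENNReal.ofReal (r ^ (Module.finrank ℝ E - 1)) *
          ∫⁻ θ, G (r • (θ : E)) ∂μ.toSphere)]

theorem integral_polar {F : Type*} [NormedAddCommGroup F] [NormedSpace ℝ F] {G : E → F}
    (hG : Integrable G μ) :
    ∫ x, G x ∂μ = ∫ r in Ioi (0 : ℝ), (r ^ (Module.finrank ℝ E - 1)) •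
      ∫ θ, G (r • (θ : E)) ∂μ.toSphere := by
  have key : ∀ x : ({(0)}ᶜ : Set E), (fun p : Metric.sphere (0 : E) 1 × Ioi (0 : ℝ) =>
      G ((p.2 : ℝ) • (p.1 : E))) (homeomorphUnitSphereProd E x) = G x := by
    intro x
    have hx : ‖(x : E)‖ ≠ 0 := norm_ne_zero_iff.2 x.2
    simp [smul_smul, hx]
  have hint : Integrable (fun p : Metric.sphere (0 : E) 1 × Ioi (0 : ℝ) =>
      G ((p.2 : ℝ) • (p.1 : E))) (μ.toSphere.prod
          (Measure.volumeIoiPow (Module.finrank ℝ E - 1))) := by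
    rw [← μ.measurePreserving_homeomorphUnitSphereProd.integrable_comp_emb
      (Homeomorph.measurableEmbedding _)]
    have : ((fun p : Metric.sphere (0 : E) 1 × Ioi (0 : ℝ) =>
      G ((p.2 : ℝ) • (p.1 : E))) ∘ (homeomorphUnitSphereProd E)) =
        fun x : ({(0)}ᶜ : Set E) => G x := funext key
    rw [this]
    have h2 := (integrableOn_iff_comap_subtypeVal (μ := μ) (f := G)
      (measurableSet_singleton (0 : E)).compl).1 hG.integrableOn
    exact h2
  calc ∫ x, G x ∂μ = ∫ x : ({(0)}ᶜ : Set E), G x ∂(μ.comap (↑)) := by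
        rw [integral_subtype_comap (measurableSet_singleton _).compl fun x ↦ G x,
          restrict_compl_singleton]
    _ = ∫ p, G ((p.2 : ℝ) • (p.1 : E)) ∂(μ.toSphere.prod
          (Measure.volumeIoiPow (Module.finrank ℝ E - 1))) := by
        rw [← μ.measurePreserving_homeomorphUnitSphereProd.integral_comp
          (Homeomorph.measurableEmbedding _)]
        exact integral_congr_ae (Eventually.of_forall fun x => (key x).symm)
    _ = ∫ r, ∫ θ, G ((r : ℝ) • (θ : E)) ∂μ.toSphere
          ∂(Measure.volumeIoiPow (Module.finrank ℝ E - 1)) := integral_prod_symm _ hint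
    _ = ∫ r : Ioi (0 : ℝ), ((r : ℝ) ^ (Module.finrank ℝ E - 1)) •
          ∫ θ, G ((r : ℝ) • (θ : E)) ∂μ.toSphere ∂(Measure.comap Subtype.val volume) := by
        simp only [Measure.volumeIoiPow, ENNReal.ofReal]
        rw [integral_withDensity_eq_integral_smul
          ((measurable_subtype_coe.pow_const _).real_toNNReal)]
        refine integral_congr_ae (Eventually.of_forall fun x => ?_)
        simp only [NNReal.smul_def]
        rw [Real.coe_toNNReal _ (pow_nonneg x.2.out.le _)]
    _ = _ := by
        rw [integral_subtype_comap measurableSet_Ioi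
          (fun r : ℝ => (r ^ (Module.finrank ℝ E - 1)) •
          ∫ θ, G (r • (θ : E)) ∂μ.toSphere)]

/-- Almost every ray meets a null set only in a null set of directions. -/
theorem ae_polar {P : E → Prop} (h : ∀ᵐ x ∂μ, P x) :
    ∀ᵐ r ∂(volume.restrict (Ioi (0 : ℝ))), ∀ᵐ θ : Metric.sphere (0 : E) 1 ∂μ.toSphere, P (r • (θ : E)) := by
  -- `P` need not be measurable, so its exceptional set is enlarged to a measurable null set.
  set N := toMeasurable μ {x | ¬ P x} with hN
  have hNm : MeasurableSet N := measurableSet_toMeasurable _ _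
  have hN0 : μ N = 0 := by rw [hN, measure_toMeasurable]; exact h
  have h0 : ∫⁻ x, N.indicator 1 x ∂μ = 0 := by rw [lintegral_indicator_one hNm, hN0]
  have hmN : Measurable (N.indicator (1 : E → ℝ≥0∞)) := measurable_one.indicator hNm
  rw [lintegral_polar μ hmN] at h0
  have hmeas : Measurable fun r : ℝ => ∫⁻ θ, N.indicator (1 : E → ℝ≥0∞) (r • (θ : E))
      ∂μ.toSphere := by
    refine Measurable.lintegral_prod_right'
      (f := fun p : ℝ × Metric.sphere (0 : E) 1 => N.indicator 1 (p.1 • (p.2 : E))) ?_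
    exact hmN.comp (by fun_prop)
  rw [lintegral_eq_zero_iff (by fun_prop)] at h0
  filter_upwards [h0, ae_restrict_mem measurableSet_Ioi] with r hr hr0
  have hr0' : (0 : ℝ) < r := hr0
  have h1 : ∫⁻ θ, N.indicator (1 : E → ℝ≥0∞) (r • (θ : E)) ∂μ.toSphere = 0 := by
    have : ENNReal.ofReal (r ^ (Module.finrank ℝ E - 1)) ≠ 0 := by
      simp only [ne_eq, ENNReal.ofReal_eq_zero, not_le]; positivity
    simpa [this] using hr
  rw [lintegral_eq_zero_iff (f := fun θ : Metric.sphere (0 : E) 1 =>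
    N.indicator (1 : E → ℝ≥0∞) (r • (θ : E))) (hmN.comp (by fun_prop))] at h1
  filter_upwards [h1] with θ hθ
  by_contra hP
  have : r • (θ : E) ∈ N := subset_toMeasurable μ _ hP
  simp [this] at hθ

theorem lintegral_radial {φ : ℝ → ℝ≥0∞} (hφ : Measurable φ) :
    ∫⁻ x, φ ‖x‖ ∂μ = μ.toSphere univ *
      ∫⁻ r in Ioi (0 : ℝ), ENNReal.ofReal (r ^ (Module.finrank ℝ E - 1)) * φ r := by
  rw [lintegral_polar μ (G := fun x => φ ‖x‖) (hφ.comp measurable_norm), ← lintegral_const_mul _ (by fun_prop)]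
  refine setLIntegral_congr_fun measurableSet_Ioi fun r hr => ?_
  have hr : 0 < r := hr
  have : ∀ θ : Metric.sphere (0 : E) 1, φ ‖r • (θ : E)‖ = φ r := fun θ => by
    simp [norm_smul, abs_of_pos hr]
  simp only [this, lintegral_const]
  ring

theorem eLpNorm_two_sq {α F : Type*} [MeasurableSpace α] [NormedAddCommGroup F] (f : α → F)
    (ν : Measure α) : eLpNorm f 2 ν ^ 2 = ∫⁻ x, ‖f x‖ₑ ^ 2 ∂ν := by
  have := eLpNorm_nnreal_pow_eq_lintegral (f := f) (μ := ν) (p := 2) (by norm_num)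
  simpa using this

/-- The `L²` norm of a radial function over a union of spheres, in the radial variable. -/
theorem eLpNorm_radial {w : ℝ → ℂ} (hw : Measurable w) {S : Set ℝ} (hS : MeasurableSet S)
    (hS0 : S ⊆ Ioi 0) :
    eLpNorm (fun x : E => w ‖x‖) 2 (μ.restrict {x | ‖x‖ ∈ S}) = μ.toSphere univ ^ (1 / 2 : ℝ) *
      eLpNorm (fun r : ℝ => ((r ^ (((Module.finrank ℝ E : ℝ) - 1) / 2) : ℝ) : ℂ) * w r) 2
        (volume.restrict S) := by
  have hd : 1 ≤ Module.finrank ℝ E := Module.finrank_pos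
  -- It suffices to compare squares, where the weight `r^((d-1)/2)` becomes the polar density
  -- `r^(d-1)`.
  have hinj : Function.Injective fun x : ℝ≥0∞ => x ^ 2 := (ENNReal.pow_right_strictMono two_ne_zero).injective
  apply hinj
  simp only
  rw [mul_pow, eLpNorm_two_sq, eLpNorm_two_sq]
  have h1 : (μ.toSphere univ ^ (1 / 2 : ℝ)) ^ 2 = μ.toSphere univ := by
    rw [← ENNReal.rpow_natCast, ← ENNReal.rpow_mul]; norm_num
  rw [h1]
  have hSE : MeasurableSet {x : E | ‖x‖ ∈ S} := measurable_norm hS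
  rw [← lintegral_indicator hSE]
  have h2 := lintegral_radial μ (φ := S.indicator fun r => ‖w r‖ₑ ^ 2)
    ((by fun_prop : Measurable fun r => ‖w r‖ₑ ^ 2).indicator hS)
  have h3 : ∀ x : E, {x : E | ‖x‖ ∈ S}.indicator (fun x => ‖w ‖x‖‖ₑ ^ 2) x =
      S.indicator (fun r => ‖w r‖ₑ ^ 2) ‖x‖ := fun x => by
    by_cases hx : ‖x‖ ∈ S <;> simp [hx]
  rw [lintegral_congr h3, h2]
  congr 1
  rw [← lintegral_indicator hS, ← lintegral_indicator measurableSet_Ioi]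
  refine lintegral_congr fun r => ?_
  by_cases hr : r ∈ S
  · have hr0 : 0 < r := hS0 hr
    rw [indicator_of_mem (hS0 hr), indicator_of_mem hr, indicator_of_mem hr, enorm_mul, mul_pow]
    congr 1
    rw [← ofReal_norm, Complex.norm_real, Real.norm_eq_abs,
      abs_of_nonneg (by positivity), ← ENNReal.ofReal_pow (by positivity), ← Real.rpow_natCast,
      ← Real.rpow_natCast, ← Real.rpow_mul hr0.le]
    congr 2
    push_cast [Nat.cast_sub hd]
    ring
  · simp [hr]

end Polar

/-- Dominated convergence with majorant `‖f‖²`. It serves for cutoffs both in space and in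
frequency. -/
theorem tendsto_eLpNorm_indicator_compl {α ι F : Type*} [MeasurableSpace α]
    [NormedAddCommGroup F] {ν : Measure α} {f : α → F} (hf : MemLp f 2 ν) {l : Filter ι}
    [l.IsCountablyGenerated] {S : ι → Set α} (hS : ∀ i, MeasurableSet (S i))
    (h : ∀ᵐ x ∂ν, ∀ᶠ i in l, x ∈ S i) :
    Tendsto (fun i => eLpNorm ((S i)ᶜ.indicator f) 2 ν) l (𝓝 0) := by
  have h2 : Tendsto (fun i => ∫⁻ x, ‖(S i)ᶜ.indicator f x‖ₑ ^ 2 ∂ν) l (𝓝 (∫⁻ _, 0 ∂ν)) := by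
    have hfin : ∫⁻ x, ‖f x‖ₑ ^ 2 ∂ν ≠ ⊤ := by
      rw [← eLpNorm_two_sq]
      exact ENNReal.pow_ne_top hf.eLpNorm_ne_top
    refine tendsto_lintegral_filter_of_dominated_convergence' (fun x => ‖f x‖ₑ ^ 2) ?_ ?_ hfin ?_
    · exact Eventually.of_forall fun i =>
        ((hf.aestronglyMeasurable.indicator (hS i).compl).enorm.pow_const 2)
    · refine Eventually.of_forall fun i => Eventually.of_forall fun x => ?_
      gcongr
      exact enorm_indicator_le_enorm_self _ _
    · filter_upwards [h] with x hx
      refine tendsto_const_nhds.congr' ?_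
      filter_upwards [hx] with i hi
      simp [hi]
  simp only [lintegral_zero, ← eLpNorm_two_sq] at h2
  have h3 := h2.ennrpow_const (1 / 2)
  have h4 : ∀ y : ℝ≥0∞, (y ^ 2) ^ (1 / 2 : ℝ) = y := fun y => by
    rw [← ENNReal.rpow_natCast, ← ENNReal.rpow_mul]; norm_num
  simpa only [h4, ENNReal.zero_rpow_of_pos one_half_pos] using h3

/-! ### Radial functions and their Fourier transforms. -/

section Radial

variable {d : ℕ}

theorem comap_norm_le : MeasurableSpace.comap (fun x : Rd d => ‖x‖) inferInstance ≤
    (inferInstance : MeasurableSpace (Rd d)) := measurable_norm.comap_le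

/-- A function measurable for the σ-algebra generated by the norm factors through the norm. In this
form radiality is a closed condition in `L²`. -/
theorem isRadial_iff_aestronglyMeasurable (f : L2 d) :
    IsRadial f ↔ AEStronglyMeasurable[MeasurableSpace.comap (fun x : Rd d => ‖x‖) inferInstance]
      f volume := by
  constructor
  · rintro ⟨g, hg, hfg⟩
    refine ⟨fun x => g ‖x‖, ?_, hfg⟩
    exact hg.stronglyMeasurable.comp_measurable (comap_measurable _)
  · rintro ⟨g, hg, hfg⟩
    obtain ⟨h, hh, rfl⟩ := hg.exists_eq_measurable_comp
    exact ⟨h, hh.measurable, hfg⟩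

theorem isClosed_isRadial : IsClosed {f : L2 d | IsRadial f} := by
  simp_rw [isRadial_iff_aestronglyMeasurable]
  exact isClosed_aestronglyMeasurable comap_norm_le

theorem indicator_memLp (S : Set (Rd d)) (hS : MeasurableSet S) (f : L2 d) :
    MemLp (S.indicator f) 2 volume := (Lp.memLp f).indicator hS

/-- Multiplication by the characteristic function of `{‖x‖ ∈ S}`. -/
def normCut (S : Set ℝ) (hS : MeasurableSet S) (f : L2 d) : L2 d :=
  (indicator_memLp {x | ‖x‖ ∈ S} (measurable_norm hS) f).toLp _

theorem normCut_ae_eq {S : Set ℝ} (hS : MeasurableSet S) (f : L2 d) :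
    normCut S hS f =ᵐ[volume] {x : Rd d | ‖x‖ ∈ S}.indicator f := MemLp.coeFn_toLp _

theorem IsRadial.normCut {S : Set ℝ} (hS : MeasurableSet S) {f : L2 d} (hf : IsRadial f) :
    IsRadial (normCut S hS f) := by
  obtain ⟨g, hg, hfg⟩ := hf
  refine ⟨S.indicator g, hg.indicator hS, (normCut_ae_eq hS f).trans ?_⟩
  filter_upwards [hfg] with x hx
  by_cases h : ‖x‖ ∈ S <;> simp [h, hx]

theorem enorm_sub_normCut {S : Set ℝ} (hS : MeasurableSet S) (f : L2 d) :
    ‖f - InOut.normCut S hS f‖ₑ = eLpNorm ({x : Rd d | ‖x‖ ∈ S}ᶜ.indicator f) 2 volume := by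
  rw [Lp.enorm_def]
  refine eLpNorm_congr_ae ?_
  filter_upwards [Lp.coeFn_sub f (InOut.normCut S hS f), normCut_ae_eq hS f] with x h1 h2
  rw [h1, Pi.sub_apply, h2]
  by_cases h : ‖x‖ ∈ S <;> simp [h]

theorem tendsto_normCut {ι : Type*} {l : Filter ι} [l.IsCountablyGenerated] {S : ι → Set ℝ}
    (hS : ∀ i, MeasurableSet (S i)) (f : L2 d) (h : ∀ᵐ x : Rd d, ∀ᶠ i in l, ‖x‖ ∈ S i) :
    Tendsto (fun i => InOut.normCut (S i) (hS i) f) l (𝓝 f) := by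
  rw [tendsto_iff_edist_tendsto_0]
  have := tendsto_eLpNorm_indicator_compl (Lp.memLp f)
    (S := fun i => {x : Rd d | ‖x‖ ∈ S i}) (fun i => measurable_norm (hS i)) h
  refine this.congr fun i => ?_
  rw [← enorm_sub_normCut, edist_comm, edist_eq_enorm_sub]

theorem integrable_normCut {S : Set ℝ} (hS : MeasurableSet S) {R : ℝ} (hSR : S ⊆ Iic R)
    (f : L2 d) : Integrable (InOut.normCut S hS f : Rd d → ℂ) := by
  rw [integrable_congr (normCut_ae_eq hS f),
    integrable_indicator_iff (s := {x : Rd d | ‖x‖ ∈ S}) (measurable_norm hS)]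
  have hsub : {x : Rd d | ‖x‖ ∈ S} ⊆ Metric.closedBall 0 R := fun x hx => by
    simpa using hSR hx
  have hfin : volume {x : Rd d | ‖x‖ ∈ S} ≠ ⊤ :=
    ((measure_mono hsub).trans_lt measure_closedBall_lt_top).ne
  have : IsFiniteMeasure (volume.restrict {x : Rd d | ‖x‖ ∈ S}) :=
    ⟨by rw [Measure.restrict_apply_univ]; exact hfin.lt_top⟩
  exact ((Lp.memLp f).restrict _).integrable (by norm_num)

/-- A continuous map on `L²` preserves radial functions if it does so on integrable ones. -/
theorem IsRadial.map_of_integrable {T : L2 d → L2 d} (hT : Continuous T)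
    (h : ∀ f : L2 d, IsRadial f → Integrable (f : Rd d → ℂ) → IsRadial (T f)) {f : L2 d}
    (hf : IsRadial f) : IsRadial (T f) := by
  -- Restricted to the ball `|x| ≤ n`, an `L²` function is integrable; the limit `n → ∞` stays in
  -- the closed set of radial functions.
  have hlim : Tendsto (fun n : ℕ => T (InOut.normCut (Iic (n : ℝ)) measurableSet_Iic f)) atTop
      (𝓝 (T f)) := by
    refine (hT.tendsto f).comp (tendsto_normCut (fun n : ℕ => measurableSet_Iic) f ?_)
    refine Eventually.of_forall fun x => ?_
    filter_upwards [eventually_ge_atTop ⌈‖x‖⌉₊] with n hn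
    exact Nat.ceil_le.1 hn
  refine isClosed_isRadial.mem_of_tendsto hlim (Eventually.of_forall fun n => ?_)
  exact h _ (hf.normCut _) (integrable_normCut _ subset_rfl f)

/-- A continuous function that is invariant under rotations depends on the norm only. -/
theorem exists_eq_norm_of_invariant {F : Rd d → ℂ} (hF : Continuous F)
    (h : ∀ (A : Rd d ≃ₗᵢ[ℝ] Rd d) x, F (A x) = F x) :
    ∃ g : ℝ → ℂ, Measurable g ∧ ∀ x, F x = g ‖x‖ := by
  -- In dimension zero there is no unit vector to choose.
  rcases subsingleton_or_nontrivial (Rd d) with hs | hs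
  · exact ⟨fun _ => F 0, measurable_const, fun x => by rw [Subsingleton.elim x 0]⟩
  · obtain ⟨e, he⟩ := exists_norm_eq (Rd d) (zero_le_one' ℝ)
    refine ⟨fun r => F (r • e), (hF.comp (by fun_prop)).measurable, fun x => ?_⟩
    have hn : ‖x‖ = ‖(‖x‖ • e)‖ := by simp [norm_smul, he]
    -- The reflection in the hyperplane orthogonal to `x - ‖x‖ e` carries `x` to `‖x‖ e`.
    have := Submodule.reflection_sub hn
    change F x = F (‖x‖ • e)
    rw [← this, h]

theorem IsRadial.fourier_invariant {f : L2 d} (hf : IsRadial f) (A : Rd d ≃ₗᵢ[ℝ] Rd d) (x : Rd d) :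
    𝓕 (f : Rd d → ℂ) (A x) = 𝓕 (f : Rd d → ℂ) x := by
  obtain ⟨g, hg, hfg⟩ := hf
  have h1 : 𝓕 (f : Rd d → ℂ) = 𝓕 (fun x : Rd d => g ‖x‖) := by
    ext w
    rw [Real.fourier_eq, Real.fourier_eq]
    refine integral_congr_ae ?_
    filter_upwards [hfg] with y hy
    rw [hy]
  have h2 := Real.fourier_comp_linearIsometry A (fun x : Rd d => g ‖x‖) x
  rw [h1, ← h2]
  simp [Function.comp_def]

theorem continuous_fourier {f : Rd d → ℂ} (hf : Integrable f) : Continuous (𝓕 f) :=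
  VectorFourier.fourierIntegral_continuous Real.continuous_fourierChar
    (by exact continuous_inner) hf

/-- For integrable `f` the transform is continuous and rotation invariant, hence a function of the
norm at every point; density does the rest. -/
theorem IsRadial.fourier {f : L2 d} (hf : IsRadial f) : IsRadial (𝓕 f : L2 d) := by
  refine IsRadial.map_of_integrable (Lp.fourierTransformₗᵢ (Rd d) ℂ).continuous
    (fun f hf hi => ?_) hf
  obtain ⟨g, hg, hfg⟩ := exists_eq_norm_of_invariant (continuous_fourier hi) hf.fourier_invariant
  refine ⟨g, hg, (fourier_Lp_ae_eq f hi).trans ?_⟩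
  exact Eventually.of_forall hfg

theorem IsRadial.fourierInv {f : L2 d} (hf : IsRadial f) : IsRadial (𝓕⁻ f : L2 d) := by
  refine IsRadial.map_of_integrable (Lp.fourierTransformₗᵢ (Rd d) ℂ).symm.continuous
    (fun f hf hi => ?_) hf
  obtain ⟨g, hg, hfg⟩ := exists_eq_norm_of_invariant (continuous_fourier hi) hf.fourier_invariant
  refine ⟨g, hg, (fourierInv_Lp_ae_eq f hi).trans ?_⟩
  exact Eventually.of_forall fun x => by rw [Real.fourierInv_eq_fourier_neg, hfg, norm_neg]

end Radial

/-! ### The Fourier transform of the sphere as a Bessel function. -/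

/-- Expansion of `∫ e^{isT} w` in the moments of a bounded function `T`. -/
theorem hasSum_integral_exp_mul {X : Type*} [MeasurableSpace X] {m : Measure X} {T w : X → ℝ}
    (hT : Measurable T) (hT1 : ∀ᵐ x ∂m, |T x| ≤ 1) (hw : Integrable w m) (s : ℝ) :
    HasSum (fun n : ℕ => (Complex.I * s) ^ n / (n.factorial : ℂ) * ((∫ x, T x ^ n * w x ∂m : ℝ) : ℂ))
      (∫ x, Complex.exp (Complex.I * (s * T x : ℝ)) * w x ∂m) := by
  set F : ℕ → X → ℂ := fun n x => (Complex.I * s) ^ n / (n.factorial : ℂ) * ((T x ^ n * w x : ℝ) : ℂ)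
    with hF
  have hTw : ∀ n : ℕ, Integrable (fun x => T x ^ n * w x) m := fun n => by
    refine hw.mono ((hT.pow_const n).aestronglyMeasurable.mul hw.aestronglyMeasurable) ?_
    filter_upwards [hT1] with x hx
    rw [norm_mul, norm_pow, Real.norm_eq_abs]
    exact mul_le_of_le_one_left (norm_nonneg _) (pow_le_one₀ (abs_nonneg _) hx)
  have hFi : ∀ n, Integrable (F n) m := fun n => ((hTw n).ofReal (𝕜 := ℂ)).const_mul _
  -- Since `|T| ≤ 1`, the `n`-th term is at most `|s|^n / n!` times the `L¹` norm of `w`; this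
  -- justifies integrating the exponential series termwise.
  have hsum : Summable fun n => ∫ x, ‖F n x‖ ∂m := by
    refine Summable.of_nonneg_of_le (fun n => integral_nonneg fun x => norm_nonneg _) (fun n => ?_)
      ((Real.summable_pow_div_factorial |s|).mul_right (∫ x, ‖w x‖ ∂m))
    rw [← integral_const_mul]
    refine integral_mono_ae (hFi n).norm (hw.norm.const_mul _) ?_
    filter_upwards [hT1] with x hx
    simp only [hF, norm_mul, norm_div, norm_pow, Complex.norm_I, Complex.norm_real, one_mul,
      Complex.norm_natCast, Real.norm_eq_abs]
    gcongr
    exact mul_le_of_le_one_left (abs_nonneg _) (pow_le_one₀ (abs_nonneg _) hx)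
  have h := hasSum_integral_of_summable_integral_norm hFi hsum
  have h1 : ∀ n, ∫ x, F n x ∂m = (Complex.I * s) ^ n / (n.factorial : ℂ) *
      ((∫ x, T x ^ n * w x ∂m : ℝ) : ℂ) := fun n => by
    rw [hF]
    simp only
    rw [integral_const_mul, integral_complex_ofReal]
  simp only [h1] at h
  have hlim : ∫ x, Complex.exp (Complex.I * (s * T x : ℝ)) * w x ∂m = ∫ x, ∑' n, F n x ∂m := by
    refine integral_congr_ae (Eventually.of_forall fun x => ?_)
    have h2 := (NormedSpace.expSeries_div_hasSum_exp (Complex.I * (s * T x : ℝ))).mul_right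
      (w x : ℂ)
    rw [← Complex.exp_eq_exp_ℂ] at h2
    simp only
    rw [← h2.tsum_eq]
    refine tsum_congr fun n => ?_
    simp only [hF]
    push_cast
    ring
  rw [hlim]
  exact h

theorem integral_pow_mul_exp_neg_sq (n : ℕ) :
    ∫ t : ℝ, t ^ n * Real.exp (-t ^ 2) = (1 + (-1) ^ n) * (1 / 2 * Real.Gamma ((n + 1) / 2)) := by
  have hi : Integrable fun t : ℝ => t ^ n * Real.exp (-t ^ 2) := by
    have := integrable_rpow_mul_exp_neg_mul_sq (b := 1) one_pos (s := n)
      (by have : (0 : ℝ) ≤ n := n.cast_nonneg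
          linarith)
    simpa using this
  have h0 : ∫ t in Ioi (0 : ℝ), t ^ n * Real.exp (-t ^ 2) = 1 / 2 * Real.Gamma ((n + 1) / 2) := by
    have := integral_rpow_mul_exp_neg_rpow (p := 2) (q := n) two_pos
      (by have : (0 : ℝ) ≤ n := n.cast_nonneg
          linarith)
    rw [← this]
    refine setIntegral_congr_fun measurableSet_Ioi fun t _ => ?_
    simp
  rw [← intervalIntegral.integral_Iic_add_Ioi hi.integrableOn hi.integrableOn (b := 0)]
  have h1 : ∫ t in Iic (0 : ℝ), t ^ n * Real.exp (-t ^ 2) =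
      (-1) ^ n * ∫ t in Ioi (0 : ℝ), t ^ n * Real.exp (-t ^ 2) := by
    have := integral_comp_neg_Ioi (0 : ℝ) (fun t : ℝ => t ^ n * Real.exp (-t ^ 2))
    rw [neg_zero] at this
    rw [← this, ← integral_const_mul]
    refine setIntegral_congr_fun measurableSet_Ioi fun t _ => ?_
    simp only [neg_sq]
    rw [neg_pow t n]
    ring
  rw [h1, h0]
  ring

/-- The Gaussian factors over the coordinates; each of the `d - 1` coordinates other than `i`
contributes `√π`. -/
theorem integral_coord_pow_mul_exp_neg_sq {d : ℕ} (i : Fin d) (n : ℕ) :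
    Integrable (fun x : Rd d => x i ^ n * Real.exp (-‖x‖ ^ 2)) ∧
    ∫ x : Rd d, x i ^ n * Real.exp (-‖x‖ ^ 2) =
      (1 + (-1) ^ n) * (1 / 2 * Real.Gamma ((n + 1) / 2)) * √Real.pi ^ (d - 1) := by
  have hg : ∀ j : Fin d, Integrable fun t : ℝ => (if j = i then t ^ n else 1) * Real.exp (-t ^ 2) := by
    intro j
    have h : ∀ n : ℕ, Integrable fun t : ℝ => t ^ n * Real.exp (-t ^ 2) := fun n => by
      have := integrable_rpow_mul_exp_neg_mul_sq (b := 1) one_pos (s := n)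
        (by have : (0 : ℝ) ≤ n := n.cast_nonneg
            linarith)
      simpa using this
    by_cases hj : j = i
    · simpa [hj] using h n
    · simpa [hj] using h 0
  have hprod : ∀ x : Rd d, x i ^ n * Real.exp (-‖x‖ ^ 2) =
      ∏ j, (if j = i then x j ^ n else 1) * Real.exp (-x j ^ 2) := fun x => by
    rw [Finset.prod_mul_distrib, ← Real.exp_sum, EuclideanSpace.norm_sq_eq]
    simp
  have hme := (MeasurableEquiv.toLp 2 (Fin d → ℝ)).measurableEmbedding
  constructor
  · rw [← (PiLp.volume_preserving_toLp (Fin d)).integrable_comp_emb hme]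
    have : (fun x : Rd d => x i ^ n * Real.exp (-‖x‖ ^ 2)) ∘ (WithLp.toLp 2) =
        fun y : Fin d → ℝ => ∏ j, (if j = i then y j ^ n else 1) * Real.exp (-y j ^ 2) := by
      ext y
      simp only [Function.comp, hprod]
    rw [this]
    exact Integrable.fintype_prod
      (f := fun j (t : ℝ) => (if j = i then t ^ n else 1) * Real.exp (-t ^ 2)) hg
  · rw [← (PiLp.volume_preserving_toLp (Fin d)).integral_comp hme]
    simp only [hprod]
    rw [integral_fintype_prod_volume_eq_prod
      (fun j (t : ℝ) => (if j = i then t ^ n else 1) * Real.exp (-t ^ 2))]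
    rw [← Finset.mul_prod_erase Finset.univ _ (Finset.mem_univ i)]
    simp only [if_true, integral_pow_mul_exp_neg_sq]
    congr 1
    have : ∀ j ∈ Finset.univ.erase i, ∫ t : ℝ, (if j = i then t ^ n else 1) * Real.exp (-t ^ 2) =
        √Real.pi := fun j hj => by
      have hji : j ≠ i := (Finset.mem_erase.1 hj).1
      have := integral_gaussian 1
      simpa [hji] using this
    rw [Finset.prod_congr rfl this]
    simp

/-- Moments of a coordinate over the unit sphere. -/
theorem sphere_moment {d : ℕ} (i : Fin d) (n : ℕ) :
    (∫ θ : Metric.sphere (0 : Rd d) 1, (θ : Rd d) i ^ n ∂(volume : Measure (Rd d)).toSphere) *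
      (1 / 2 * Real.Gamma ((n + d) / 2)) =
      (1 + (-1) ^ n) * (1 / 2 * Real.Gamma ((n + 1) / 2)) * √Real.pi ^ (d - 1) := by
  have hd : 0 < d := i.pos
  have : Nontrivial (Rd d) := by
    have : Nonempty (Fin d) := ⟨i⟩
    infer_instance
  -- The integral of `x_i^n e^{-|x|²}` is computed twice, in Cartesian and in polar coordinates. The
  -- radial factor is `∫ t^(n+d-1) e^{-t²} dt`.
  obtain ⟨hint, hval⟩ := integral_coord_pow_mul_exp_neg_sq i n
  rw [← hval, integral_polar volume hint, finrank_euclideanSpace_fin]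
  have h0 : ∫ t in Ioi (0 : ℝ), t ^ (n + d - 1) * Real.exp (-t ^ 2) =
      1 / 2 * Real.Gamma ((n + d) / 2) := by
    have := integral_rpow_mul_exp_neg_rpow (p := 2) (q := (n + d - 1 : ℕ)) two_pos
      (by have : (0 : ℝ) ≤ (n + d - 1 : ℕ) := Nat.cast_nonneg _
          linarith)
    have hc : (((n + d - 1 : ℕ) : ℝ) + 1) = n + d := by
      rw [Nat.cast_sub (by omega)]; push_cast; ring
    rw [hc] at this
    rw [← this]
    refine setIntegral_congr_fun measurableSet_Ioi fun t _ => ?_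
    simp only [Real.rpow_natCast, Real.rpow_two]
  rw [← h0, ← integral_const_mul]
  refine setIntegral_congr_fun measurableSet_Ioi fun r hr => ?_
  have hr : 0 < r := hr
  simp only [PiLp.smul_apply, smul_eq_mul, norm_smul, norm_eq_of_mem_sphere, mul_one,
    Real.norm_eq_abs, sq_abs, mul_pow]
  rw [integral_mul_const, integral_const_mul]
  have : n + d - 1 = n + (d - 1) := by omega
  rw [this, pow_add]
  ring

/-- The substitution `y = t²` turns this into a Beta integral. -/
theorem integral_zero_one_pow_mul (n : ℕ) {a : ℝ} (ha : -1 < a) :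
    ∫ t in (0 : ℝ)..1, t ^ n * (1 - t ^ 2) ^ a = 1 / 2 *
      (Real.Gamma ((n + 1) / 2) * Real.Gamma (a + 1) / Real.Gamma ((n + 1) / 2 + (a + 1))) := by
  have hn : (0 : ℝ) ≤ n := n.cast_nonneg
  set u : ℝ := (n + 1) / 2 with hu
  have hupos : 0 < u := by positivity
  set g : ℝ → ℝ := (Ioc (0 : ℝ) 1).indicator fun y => y ^ (u - 1) * (1 - y) ^ a with hg
  have hbeta : ∫ y in Ioi (0 : ℝ), g y =
      Real.Gamma u * Real.Gamma (a + 1) / Real.Gamma (u + (a + 1)) := by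
    rw [hg, setIntegral_indicator measurableSet_Ioc,
      inter_eq_self_of_subset_right (s := Ioi (0 : ℝ)) (fun x (hx : x ∈ Ioc (0 : ℝ) 1) => hx.1)]
    have h := Complex.betaIntegral_eq_Gamma_mul_div (u : ℂ) ((a + 1 : ℝ) : ℂ) (by simpa using hupos)
      (by rw [Complex.ofReal_re]; linarith)
    rw [Complex.betaIntegral, intervalIntegral.integral_of_le zero_le_one] at h
    have h2 : ∀ x ∈ Ioc (0 : ℝ) 1, (x : ℂ) ^ ((u : ℂ) - 1) * (1 - (x : ℂ)) ^ (((a + 1 : ℝ) : ℂ) - 1) =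
        ((x ^ (u - 1) * (1 - x) ^ a : ℝ) : ℂ) := fun x hx => by
      rw [Complex.ofReal_mul, Complex.ofReal_cpow hx.1.le,
        Complex.ofReal_cpow (sub_nonneg.2 hx.2)]
      push_cast
      congr 2
      ring
    rw [setIntegral_congr_fun measurableSet_Ioc h2, integral_complex_ofReal, ← Complex.ofReal_add,
      Complex.Gamma_ofReal, Complex.Gamma_ofReal, Complex.Gamma_ofReal] at h
    exact_mod_cast h
  rw [← hbeta, ← integral_comp_rpow_Ioi_of_pos (g := g) two_pos, ← integral_const_mul,
    intervalIntegral.integral_of_le zero_le_one]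
  have hsub : Ioc (0 : ℝ) 1 ⊆ Ioi 0 := fun x hx => hx.1
  rw [← inter_eq_self_of_subset_right hsub, ← setIntegral_indicator measurableSet_Ioc]
  refine setIntegral_congr_fun measurableSet_Ioi fun t ht => ?_
  have ht : 0 < t := ht
  have hmem : t ^ (2 : ℝ) ∈ Ioc (0 : ℝ) 1 ↔ t ∈ Ioc (0 : ℝ) 1 := by
    rw [Real.rpow_two]
    constructor
    · rintro ⟨_, h⟩
      exact ⟨ht, by nlinarith⟩
    · rintro ⟨_, h⟩
      exact ⟨by positivity, by nlinarith⟩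
  by_cases h : t ∈ Ioc (0 : ℝ) 1
  · simp only [indicator_of_mem h, hg, indicator_of_mem (hmem.2 h), smul_eq_mul]
    rw [Real.rpow_two, ← Real.rpow_natCast t 2, ← Real.rpow_mul ht.le, ← Real.rpow_natCast t n]
    have : (n : ℝ) = (2 - 1) + (2 : ℕ) * (u - 1) := by rw [hu]; push_cast; ring
    rw [this, Real.rpow_add ht]
    ring
  · simp only [indicator_of_notMem h, hg, indicator_of_notMem (mt hmem.1 h), smul_zero, mul_zero]

theorem integral_neg_one_one_eq {F : Type*} [NormedAddCommGroup F] [NormedSpace ℝ F] {f : ℝ → F}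
    (hf : IntervalIntegrable f volume (-1) 1) :
    ∫ t in (-1 : ℝ)..1, f t = ∫ t in (0 : ℝ)..1, (f t + f (-t)) := by
  have h1 : IntervalIntegrable f volume (-1) 0 :=
    hf.mono_set (by simp [uIcc_of_le, Icc_subset_Icc])
  have h2 : IntervalIntegrable f volume 0 1 :=
    hf.mono_set (by simp [uIcc_of_le, Icc_subset_Icc])
  have h3 : IntervalIntegrable (fun t => f (-t)) volume 0 1 := by
    have := ((IntervalIntegrable.iff_comp_neg).1 h1).symm
    simpa using this
  rw [intervalIntegral.integral_add h2 h3, intervalIntegral.integral_comp_neg, neg_zero, add_comm,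
    intervalIntegral.integral_add_adjacent_intervals h1 h2]

theorem continuous_one_sub_sq_rpow {a : ℝ} (ha : 0 ≤ a) :
    Continuous fun t : ℝ => (1 - t ^ 2) ^ a :=
  Continuous.rpow_const (by fun_prop) fun _ => Or.inr ha

theorem integral_neg_one_one_pow_mul (n : ℕ) {a : ℝ} (ha : 0 ≤ a) :
    ∫ t in (-1 : ℝ)..1, t ^ n * (1 - t ^ 2) ^ a = (1 + (-1) ^ n) * (1 / 2 *
      (Real.Gamma ((n + 1) / 2) * Real.Gamma (a + 1) / Real.Gamma ((n + 1) / 2 + (a + 1)))) := by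
  rw [← integral_zero_one_pow_mul n (by linarith), integral_neg_one_one_eq,
    ← intervalIntegral.integral_const_mul]
  · refine intervalIntegral.integral_congr fun t _ => ?_
    simp only [neg_sq]
    rw [neg_pow t n]
    ring
  · exact ((continuous_pow n).mul (continuous_one_sub_sq_rpow ha)).intervalIntegrable _ _

/-- The Fourier transform of surface measure on the sphere, by Poisson's integral. -/
theorem sphere_integral_exp_eq_integral {d : ℕ} (hd : 3 ≤ d) (i : Fin d) (s : ℝ) :
    ∫ θ : Metric.sphere (0 : Rd d) 1, Complex.exp (Complex.I * (s * (θ : Rd d) i : ℝ))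
      ∂(volume : Measure (Rd d)).toSphere =
    ((2 * √Real.pi ^ (d - 1) / Real.Gamma (((d : ℝ) - 1) / 2) : ℝ) : ℂ) *
      ∫ t in (-1 : ℝ)..1, Complex.exp (Complex.I * (s * t : ℝ)) *
        (((1 - t ^ 2) ^ (((d : ℝ) - 3) / 2) : ℝ) : ℂ) := by
  have hd' : (3 : ℝ) ≤ d := by exact_mod_cast hd
  have ha : 0 ≤ ((d : ℝ) - 3) / 2 := by linarith
  have h1 := hasSum_integral_exp_mul (m := (volume : Measure (Rd d)).toSphere)
    (T := fun θ : Metric.sphere (0 : Rd d) 1 => (θ : Rd d) i) (w := fun _ => 1)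
    (by fun_prop) (Eventually.of_forall fun θ => by
      have := PiLp.norm_apply_le (θ : Rd d) i
      simpa using this) (integrable_const _) s
  have h2 := hasSum_integral_exp_mul (m := volume.restrict (Ioc (-1 : ℝ) 1))
    (T := fun t => t) (w := fun t => (1 - t ^ 2) ^ (((d : ℝ) - 3) / 2)) measurable_id
    (by filter_upwards [ae_restrict_mem measurableSet_Ioc] with t ht
        exact abs_le.2 ⟨ht.1.le, ht.2⟩)
    (((continuous_one_sub_sq_rpow ha).intervalIntegrable (-1) 1).1) s
  rw [intervalIntegral.integral_of_le (by norm_num)]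
  simp only [Complex.ofReal_one, mul_one] at h1
  have h3 := h2.mul_left ((2 * √Real.pi ^ (d - 1) / Real.Gamma (((d : ℝ) - 1) / 2) : ℝ) : ℂ)
  -- Both sides are power series in `s`, so it is enough to match the moments of a coordinate on the
  -- sphere with those of `(1 - t²)^((d-3)/2)`.
  refine h1.unique ?_
  refine h3.congr_fun fun n => ?_
  rw [← intervalIntegral.integral_of_le (by norm_num), integral_neg_one_one_pow_mul n ha]
  have hn : (0 : ℝ) ≤ n := n.cast_nonneg
  have hm := sphere_moment i n
  have hG1 : Real.Gamma ((n + d) / 2) ≠ 0 := (Real.Gamma_pos_of_pos (by linarith)).ne'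
  have hG2 : Real.Gamma (((d : ℝ) - 1) / 2) ≠ 0 := (Real.Gamma_pos_of_pos (by linarith)).ne'
  have e1 : ((d : ℝ) - 3) / 2 + 1 = ((d : ℝ) - 1) / 2 := by ring
  have e2 : ((n : ℝ) + 1) / 2 + ((d : ℝ) - 1) / 2 = (n + d) / 2 := by ring
  rw [e1, e2, mul_left_comm, ← Complex.ofReal_mul]
  congr 2
  rw [← eq_div_iff (by simpa using hG1)] at hm
  rw [hm]
  field_simp

/-- Folding `[-1, 1]` onto `[0, 1]` replaces the exponential by `2 cos(st)`, which is Poisson's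
integral for `J`; the rest is bookkeeping of constants. -/
theorem sphere_integral_exp {d : ℕ} (hd : 3 ≤ d) (i : Fin d) {s : ℝ} (hs : 0 < s) :
    ∫ θ : Metric.sphere (0 : Rd d) 1, Complex.exp (Complex.I * (s * (θ : Rd d) i : ℝ))
      ∂(volume : Measure (Rd d)).toSphere =
    (((2 * Real.pi) ^ ((d : ℝ) / 2) * s ^ (-(((d : ℝ) - 2) / 2)) *
      besselJ (((d : ℝ) - 2) / 2) s : ℝ) : ℂ) := by
  have hd' : (3 : ℝ) ≤ d := by exact_mod_cast hd
  have ha : 0 ≤ ((d : ℝ) - 3) / 2 := by linarith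
  have hcont := continuous_one_sub_sq_rpow ha
  rw [sphere_integral_exp_eq_integral hd, integral_neg_one_one_eq
    (Continuous.intervalIntegrable (by fun_prop) _ _)]
  have h1 : ∀ t : ℝ, Complex.exp (Complex.I * (s * t : ℝ)) *
        (((1 - t ^ 2) ^ (((d : ℝ) - 3) / 2) : ℝ) : ℂ) +
      Complex.exp (Complex.I * (s * (-t) : ℝ)) *
        (((1 - (-t) ^ 2) ^ (((d : ℝ) - 3) / 2) : ℝ) : ℂ) =
      ((2 * ((1 - t ^ 2) ^ (((d : ℝ) - 3) / 2) * Real.cos (s * t)) : ℝ) : ℂ) := fun t => by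
    rw [neg_sq]
    push_cast
    rw [Complex.cos]
    have : Complex.I * (s * -(t : ℂ)) = -(s * t) * Complex.I := by ring
    rw [this, mul_comm Complex.I]
    ring
  simp only [h1]
  rw [intervalIntegral.integral_ofReal, ← Complex.ofReal_mul, intervalIntegral.integral_const_mul]
  congr 1
  rw [besselJ]
  have e1 : ((d : ℝ) - 2) / 2 - 1 / 2 = ((d : ℝ) - 3) / 2 := by ring
  have e2 : ((d : ℝ) - 2) / 2 + 1 / 2 = ((d : ℝ) - 1) / 2 := by ring
  rw [e1, e2]
  have hG2 : Real.Gamma (((d : ℝ) - 1) / 2) ≠ 0 := (Real.Gamma_pos_of_pos (by linarith)).ne'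
  have hpi := Real.pi_pos
  have e3 : √Real.pi ^ (d - 1) * √Real.pi = Real.pi ^ ((d : ℝ) / 2) := by
    rw [← pow_succ, Nat.sub_add_cancel (by omega), Real.sqrt_eq_rpow, ← Real.rpow_natCast,
      ← Real.rpow_mul hpi.le]
    congr 1
    ring
  have e4 : (2 * Real.pi) ^ ((d : ℝ) / 2) * s ^ (-(((d : ℝ) - 2) / 2)) *
      (s / 2) ^ (((d : ℝ) - 2) / 2) = 2 * Real.pi ^ ((d : ℝ) / 2) := by
    rw [Real.mul_rpow two_pos.le hpi.le, Real.div_rpow hs.le two_pos.le, Real.rpow_neg hs.le]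
    have : (2 : ℝ) ^ ((d : ℝ) / 2) = 2 ^ (((d : ℝ) - 2) / 2) * 2 := by
      rw [← Real.rpow_add_one two_ne_zero]
      congr 1
      ring
    rw [this]
    have h2 : (2 : ℝ) ^ (((d : ℝ) - 2) / 2) ≠ 0 := (Real.rpow_pos_of_pos two_pos _).ne'
    have h3 : s ^ (((d : ℝ) - 2) / 2) ≠ 0 := (Real.rpow_pos_of_pos hs _).ne'
    field_simp
  have hsp : √Real.pi ≠ 0 := (Real.sqrt_pos.2 hpi).ne'
  set J := ∫ t in (0 : ℝ)..1, (1 - t ^ 2) ^ (((d : ℝ) - 3) / 2) * Real.cos (s * t)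
  calc _ = (√Real.pi ^ (d - 1) * √Real.pi) * (4 * J / (√Real.pi * Real.Gamma (((d : ℝ) - 1) / 2))) := by
        field_simp
        ring
    _ = _ := by
        rw [e3]
        have : Real.pi ^ ((d : ℝ) / 2) = (2 * Real.pi) ^ ((d : ℝ) / 2) *
          s ^ (-(((d : ℝ) - 2) / 2)) * (s / 2) ^ (((d : ℝ) - 2) / 2) / 2 := by rw [e4]; ring
        rw [this]
        ring

/-! ### The contour shift for Poisson's integral. -/

/-- Raise `y ≤ e^y` with `y = b(2+s)/(p+1)` to the power `p`. Dividing by `p + 1` rather than `p`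
admits `p = 0`. -/
theorem two_add_rpow_mul_exp_le {p b s : ℝ} (hp : 0 ≤ p) (hb : 0 < b) (hs : 0 ≤ s) :
    (2 + s) ^ p * Real.exp (-(b * s)) ≤ ((p + 1) / b) ^ p * Real.exp (2 * b) := by
  have h1 : 2 + s ≤ (p + 1) / b * Real.exp (b * (2 + s) / (p + 1)) := by
    have := Real.add_one_le_exp (b * (2 + s) / (p + 1))
    calc 2 + s = (p + 1) / b * (b * (2 + s) / (p + 1)) := by field_simp
      _ ≤ _ := by gcongr; linarith
  have h2 : (2 + s) ^ p ≤ ((p + 1) / b) ^ p * Real.exp (b * (2 + s)) := by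
    calc (2 + s) ^ p ≤ ((p + 1) / b * Real.exp (b * (2 + s) / (p + 1))) ^ p := by gcongr
      _ = ((p + 1) / b) ^ p * Real.exp (b * (2 + s) / (p + 1) * p) := by
        rw [Real.mul_rpow (by positivity) (Real.exp_pos _).le, ← Real.exp_mul]
      _ ≤ _ := by
        refine mul_le_mul_of_nonneg_left (Real.exp_le_exp.2 ?_) (by positivity)
        rw [div_mul_eq_mul_div, div_le_iff₀ (by positivity)]
        have : 0 ≤ b * (2 + s) := by positivity
        nlinarith
  calc (2 + s) ^ p * Real.exp (-(b * s))
      ≤ ((p + 1) / b) ^ p * Real.exp (b * (2 + s)) * Real.exp (-(b * s)) := by gcongr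
    _ = _ := by
      rw [mul_assoc, ← Real.exp_add]
      congr 2
      ring

section Contour

/-- The integrand of Poisson's integral for the Hankel function. -/
def poissonKernel (a x : ℝ) (z : ℂ) : ℂ := (1 - z ^ 2) ^ (a : ℂ) * Complex.exp (Complex.I * x * z)

/-- Here `|1 - z²| ≤ (2 + s)²`. Half of the decay `e^{-xs}` absorbs this growth and the other half
survives, uniformly in `t`. -/
theorem norm_poissonKernel_le {a x t s : ℝ} (ha : 0 ≤ a) (hx : 0 < x) (ht : t ∈ Icc (0 : ℝ) 1)
    (hs : 0 ≤ s) : ‖poissonKernel a x (t + s * Complex.I)‖ ≤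
      ((2 * a + 1) / (x / 2)) ^ (2 * a) * Real.exp (2 * (x / 2)) * Real.exp (-(x / 2) * s) := by
  rw [poissonKernel, norm_mul, Complex.norm_cpow_real, Complex.norm_exp]
  have h1 : ‖1 - ((t : ℂ) + s * Complex.I) ^ 2‖ ≤ (2 + s) ^ (2 : ℝ) := by
    have h2 : ‖(t : ℂ) + s * Complex.I‖ ≤ 1 + s := by
      refine (norm_add_le _ _).trans ?_
      rw [norm_mul, Complex.norm_I, Complex.norm_real, Complex.norm_real, Real.norm_eq_abs,
        Real.norm_eq_abs, abs_of_nonneg hs, abs_of_nonneg ht.1]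
      linarith [ht.2]
    refine (norm_sub_le _ _).trans ?_
    rw [norm_one, norm_pow, Real.rpow_two]
    nlinarith [norm_nonneg ((t : ℂ) + s * Complex.I)]
  have h3 : (Complex.I * x * (t + s * Complex.I)).re = -(x / 2 * s) + -(x / 2) * s := by
    simp
    ring
  rw [h3, Real.exp_add, ← mul_assoc]
  refine mul_le_mul_of_nonneg_right ?_ (Real.exp_pos _).le
  refine le_trans ?_ (two_add_rpow_mul_exp_le (by positivity) (half_pos hx) hs)
  gcongr
  calc _ ≤ ((2 + s) ^ (2 : ℝ)) ^ a := by gcongr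
    _ = _ := by rw [← Real.rpow_mul (by positivity)]

/-- On the strip `0 ≤ Re z ≤ 1` the number `1 - z²` is never negative real. It vanishes at `z = 1`,
where the power is still continuous if `a > 0`; for `a = 0` the power is constant. -/
theorem continuousAt_poissonKernel {a x : ℝ} (ha : 0 ≤ a) {z : ℂ} (h0 : 0 ≤ z.re) (h1 : z.re ≤ 1) :
    ContinuousAt (poissonKernel a x) z := by
  refine ContinuousAt.mul ?_ (by fun_prop)
  rcases ha.eq_or_lt with rfl | ha
  · simp only [Complex.ofReal_zero, Complex.cpow_zero]
    exact continuousAt_const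
  · have hc : ContinuousAt (fun w : ℂ => w ^ (a : ℂ)) (1 - z ^ 2) := by
      refine Complex.continuousAt_cpow_const_of_re_pos ?_ (by simpa using ha)
      by_cases him : z.re * z.im = 0
      · left
        have : (1 - z ^ 2).re = 1 - z.re ^ 2 + z.im ^ 2 := by simp [sq]; ring
        rw [this]
        nlinarith [sq_nonneg z.im]
      · right
        have : (1 - z ^ 2).im = -(2 * (z.re * z.im)) := by simp [sq]; ring
        rw [this]
        simpa using him
    exact ContinuousAt.comp (f := fun z : ℂ => 1 - z ^ 2) hc (by fun_prop)

theorem differentiableAt_poissonKernel {a x : ℝ} {z : ℂ} (h0 : 0 < z.re) (h1 : 0 < z.im) :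
    DifferentiableAt ℂ (poissonKernel a x) z := by
  refine DifferentiableAt.mul ?_ (by fun_prop)
  refine DifferentiableAt.cpow_const (by fun_prop) ?_
  rw [Complex.mem_slitPlane_iff]
  right
  have : (1 - z ^ 2).im = -(2 * (z.re * z.im)) := by simp [sq]; ring
  rw [this]
  have := mul_pos h0 h1
  linarith

theorem poissonKernel_integrableOn {a x t : ℝ} (ha : 0 ≤ a) (hx : 0 < x) (ht : t ∈ Icc (0 : ℝ) 1) :
    IntegrableOn (fun s : ℝ => poissonKernel a x (t + s * Complex.I)) (Ioi 0) := by
  refine ((exp_neg_integrableOn_Ioi 0 (half_pos hx)).const_mul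
    (((2 * a + 1) / (x / 2)) ^ (2 * a) * Real.exp (2 * (x / 2)))).mono' ?_ ?_
  · refine ContinuousOn.aestronglyMeasurable (fun s hs => ?_) measurableSet_Ioi
    refine ContinuousAt.continuousWithinAt ?_
    exact ContinuousAt.comp (f := fun s : ℝ => (t : ℂ) + s * Complex.I)
      (continuousAt_poissonKernel ha (by simpa using ht.1) (by simpa using ht.2)) (by fun_prop)
  · filter_upwards [ae_restrict_mem measurableSet_Ioi] with s hs
    exact norm_poissonKernel_le ha hx ht (le_of_lt hs)

/-- Shifting the contour from the segment `[0, 1]` and the ray `i [0, ∞)` to `1 + i [0, ∞)`. -/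
theorem poissonKernel_contour {a x : ℝ} (ha : 0 ≤ a) (hx : 0 < x) :
    (∫ t in (0 : ℝ)..1, poissonKernel a x t) +
      Complex.I * (∫ s in Ioi (0 : ℝ), poissonKernel a x (1 + s * Complex.I)) -
      Complex.I * (∫ s in Ioi (0 : ℝ), poissonKernel a x (s * Complex.I)) = 0 := by
  have hrect : ∀ R : ℝ, 0 ≤ R → (∫ t in (0 : ℝ)..1, poissonKernel a x t) -
      (∫ t in (0 : ℝ)..1, poissonKernel a x (t + R * Complex.I)) +
      Complex.I * (∫ s in (0 : ℝ)..R, poissonKernel a x (1 + s * Complex.I)) -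
      Complex.I * (∫ s in (0 : ℝ)..R, poissonKernel a x (s * Complex.I)) = 0 := by
    intro R hR
    have := Complex.integral_boundary_rect_eq_zero_of_continuousOn_of_differentiableOn
      (poissonKernel a x) 0 (1 + R * Complex.I) ?_ ?_
    · simpa using this
    · intro z hz
      rw [Complex.mem_reProdIm] at hz
      have h := hz.1
      simp only [Complex.zero_re, Complex.add_re, Complex.one_re, Complex.mul_re, Complex.ofReal_re,
        Complex.I_re, mul_zero, Complex.ofReal_im, Complex.I_im, mul_one, sub_self, add_zero,
        uIcc_of_le zero_le_one] at h
      exact (continuousAt_poissonKernel ha h.1 h.2).continuousWithinAt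
    · intro z hz
      rw [Complex.mem_reProdIm] at hz
      have h := hz.1.1
      have h' := hz.2.1
      simp [hR] at h h'
      exact (differentiableAt_poissonKernel h h').differentiableWithinAt
  -- Cauchy's theorem holds on the rectangle of height `R`; its top edge disappears in the limit.
  have htop : Tendsto (fun R : ℝ => ∫ t in (0 : ℝ)..1, poissonKernel a x (t + R * Complex.I)) atTop
      (𝓝 0) := by
    set B := ((2 * a + 1) / (x / 2)) ^ (2 * a) * Real.exp (2 * (x / 2))
    have hB : Tendsto (fun R : ℝ => B * Real.exp (-(x / 2) * R)) atTop (𝓝 0) := by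
      rw [← mul_zero B]
      refine Tendsto.const_mul _ (Real.tendsto_exp_atBot.comp ?_)
      exact tendsto_id.const_mul_atTop_of_neg (by linarith)
    refine squeeze_zero_norm' ?_ hB
    filter_upwards [eventually_ge_atTop 0] with R hR
    have := intervalIntegral.norm_integral_le_of_norm_le_const (a := 0) (b := 1)
      (f := fun t : ℝ => poissonKernel a x (t + R * Complex.I)) (C := B * Real.exp (-(x / 2) * R))
      (fun t ht => by
        rw [uIoc_of_le zero_le_one] at ht
        exact norm_poissonKernel_le ha hx ⟨ht.1.le, ht.2⟩ hR)
    simpa using this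
  have h1 := poissonKernel_integrableOn ha hx (t := 1) (by simp)
  have h0 := poissonKernel_integrableOn ha hx (t := 0) (by simp)
  simp only [Complex.ofReal_one, Complex.ofReal_zero, zero_add] at h0 h1
  have hlim := (((htop.const_sub (∫ t in (0 : ℝ)..1, poissonKernel a x t)).add
    ((intervalIntegral_tendsto_integral_Ioi 0 h1 tendsto_id).const_mul Complex.I)).sub
    ((intervalIntegral_tendsto_integral_Ioi 0 h0 tendsto_id).const_mul Complex.I))
  rw [sub_zero] at hlim
  refine tendsto_nhds_unique hlim (tendsto_const_nhds.congr' ?_)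
  filter_upwards [eventually_ge_atTop 0] with R hR
  exact (hrect R hR).symm

end Contour

/-! ### Hankel functions at large argument. -/

/-- `H^{(1)}_ν` as a Laplace integral along `1 + i [0, ∞)`. -/
theorem hankelOne_eq {ν x : ℝ} (hν : 1 / 2 ≤ ν) (hx : 0 < x) :
    hankelOne ν x = ((2 * (x / 2) ^ ν / (√Real.pi * Real.Gamma (ν + 1 / 2)) : ℝ) : ℂ) *
      (-Complex.I * ∫ s in Ioi (0 : ℝ), poissonKernel (ν - 1 / 2) x (1 + s * Complex.I)) := by
  have ha : 0 ≤ ν - 1 / 2 := by linarith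
  set a := ν - 1 / 2 with ha'
  have hcont := continuous_one_sub_sq_rpow ha
  have h1 : ∫ t in (0 : ℝ)..1, poissonKernel a x t =
      ((∫ t in (0 : ℝ)..1, (1 - t ^ 2) ^ a * Real.cos (x * t) : ℝ) : ℂ) +
      Complex.I * ((∫ t in (0 : ℝ)..1, (1 - t ^ 2) ^ a * Real.sin (x * t) : ℝ) : ℂ) := by
    rw [← intervalIntegral.integral_ofReal, ← intervalIntegral.integral_ofReal,
      ← intervalIntegral.integral_const_mul, ← intervalIntegral.integral_add]
    · refine intervalIntegral.integral_congr fun t ht => ?_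
      rw [uIcc_of_le zero_le_one] at ht
      simp only [poissonKernel]
      have : (1 - (t : ℂ) ^ 2) ^ (a : ℂ) = (((1 - t ^ 2) ^ a : ℝ) : ℂ) := by
        rw [Complex.ofReal_cpow (by nlinarith [ht.1, ht.2])]
        push_cast
        rfl
      rw [this, show Complex.I * x * (t : ℂ) = (x * t : ℝ) * Complex.I by push_cast; ring,
        Complex.exp_mul_I, ← Complex.ofReal_cos, ← Complex.ofReal_sin]
      push_cast
      ring
    · exact Continuous.intervalIntegrable (by fun_prop) _ _
    · exact Continuous.intervalIntegrable (by fun_prop) _ _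
  have h2 : ∫ s in Ioi (0 : ℝ), poissonKernel a x (s * Complex.I) =
      ((∫ t in Ioi (0 : ℝ), (1 + t ^ 2) ^ a * Real.exp (-(x * t)) : ℝ) : ℂ) := by
    rw [← integral_complex_ofReal]
    refine setIntegral_congr_fun measurableSet_Ioi fun s hs => ?_
    simp only [poissonKernel]
    have e1 : (1 - ((s : ℂ) * Complex.I) ^ 2) = ((1 + s ^ 2 : ℝ) : ℂ) := by
      rw [mul_pow, Complex.I_sq]; push_cast; ring
    have e2 : Complex.I * x * ((s : ℂ) * Complex.I) = ((-(x * s) : ℝ) : ℂ) := by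
      push_cast
      linear_combination (x * s : ℂ) * Complex.I_mul_I
    rw [e1, e2, ← Complex.ofReal_cpow (by positivity), ← Complex.ofReal_exp]
    push_cast
    rfl
  have h3 := poissonKernel_contour ha hx
  rw [h1, h2] at h3
  rw [hankelOne, besselJ, besselY, ← ha']
  push_cast at h3 ⊢
  -- In `J + iY` the cosine and sine integrals form the integral over `[0, 1]`, and the last
  -- integral of `Y` is the one along the imaginary axis.
  linear_combination (2 * ((x / 2 : ℝ) ^ ν : ℝ) / (√Real.pi * Real.Gamma (ν + 1 / 2)) : ℂ) * h3

theorem ofReal_mul_cpow {s : ℝ} (hs : 0 < s) {w : ℂ} (hw : w ≠ 0) (a : ℝ) :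
    ((s : ℂ) * w) ^ (a : ℂ) = ((s ^ a : ℝ) : ℂ) * w ^ (a : ℂ) := by
  have hs' : (s : ℂ) ≠ 0 := by exact_mod_cast hs.ne'
  rw [Complex.ofReal_cpow hs.le, Complex.cpow_def_of_ne_zero (mul_ne_zero hs' hw),
    Complex.cpow_def_of_ne_zero hs', Complex.cpow_def_of_ne_zero hw, ← Complex.exp_add,
    Complex.log_ofReal_mul hs hw, Complex.ofReal_log hs.le]
  ring_nf

/-- Since `1 - (1 + is)² = s(s - 2i)` with `s > 0`, the power splits without a branch correction. -/
theorem poissonKernel_one_add {a x s : ℝ} (hs : 0 < s) :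
    poissonKernel a x (1 + s * Complex.I) = Complex.exp (Complex.I * x) *
      (((s ^ a * Real.exp (-(x * s)) : ℝ) : ℂ) * ((s : ℂ) - 2 * Complex.I) ^ (a : ℂ)) := by
  have hw : (s : ℂ) - 2 * Complex.I ≠ 0 := fun h => by
    have := congrArg Complex.im h
    simp at this
  have e1 : 1 - (1 + (s : ℂ) * Complex.I) ^ 2 = s * ((s : ℂ) - 2 * Complex.I) := by
    linear_combination -(s : ℂ) ^ 2 * Complex.I_sq
  have e2 : Complex.I * x * (1 + (s : ℂ) * Complex.I) = Complex.I * x + ((-(x * s) : ℝ) : ℂ) := by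
    push_cast
    linear_combination (x * s : ℂ) * Complex.I_sq
  rw [poissonKernel, e1, e2, ofReal_mul_cpow hs hw, Complex.exp_add, ← Complex.ofReal_exp]
  push_cast
  ring

/-- Mean value inequality: the derivative is `a (t - 2i)^(a-1)`, and `|t - 2i| ≥ 1` allows the
exponent `a - 1` to be raised to `a`. The factor `a` is kept because it vanishes for `ν = 1/2`. -/
theorem norm_sub_two_I_cpow_sub_le {a s : ℝ} (ha : 0 ≤ a) (hs : 0 ≤ s) :
    ‖((s : ℂ) - 2 * Complex.I) ^ (a : ℂ) - (-2 * Complex.I) ^ (a : ℂ)‖ ≤ a * (2 + s) ^ a * s := by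
  have hderiv : ∀ t ∈ Icc (0 : ℝ) s, HasDerivWithinAt
      (fun t : ℝ => ((t : ℂ) - 2 * Complex.I) ^ (a : ℂ))
      (a * ((t : ℂ) - 2 * Complex.I) ^ ((a : ℂ) - 1) * 1) (Icc 0 s) t := by
    intro t _
    have h1 : HasDerivAt (fun z : ℂ => z - 2 * Complex.I) 1 (t : ℂ) := (hasDerivAt_id _).sub_const _
    have h2 := h1.cpow_const (c := (a : ℂ)) (by
      rw [Complex.mem_slitPlane_iff]
      right
      simp)
    exact h2.comp_ofReal.hasDerivWithinAt
  have hbound : ∀ t ∈ Ico (0 : ℝ) s,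
      ‖a * ((t : ℂ) - 2 * Complex.I) ^ ((a : ℂ) - 1) * 1‖ ≤ a * (2 + s) ^ a := by
    intro t ht
    rw [mul_one, norm_mul, Complex.norm_real, Real.norm_eq_abs, abs_of_nonneg ha,
      show (a : ℂ) - 1 = ((a - 1 : ℝ) : ℂ) by push_cast; rfl, Complex.norm_cpow_real]
    have hlow : 1 ≤ ‖(t : ℂ) - 2 * Complex.I‖ := by
      have := Complex.abs_im_le_norm ((t : ℂ) - 2 * Complex.I)
      simp at this
      linarith
    have hup : ‖(t : ℂ) - 2 * Complex.I‖ ≤ 2 + s := by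
      refine (norm_sub_le _ _).trans ?_
      rw [norm_mul, Complex.norm_I, Complex.norm_real, Real.norm_eq_abs, abs_of_nonneg ht.1]
      norm_num
      linarith [ht.2]
    gcongr
    calc _ ≤ ‖(t : ℂ) - 2 * Complex.I‖ ^ a :=
          Real.rpow_le_rpow_of_exponent_le hlow (by linarith)
      _ ≤ _ := by gcongr
  have := norm_image_sub_le_of_norm_deriv_le_segment' hderiv hbound s ⟨hs, le_rfl⟩
  simpa using this

/-- The leading coefficient in the large argument asymptotics of `√x H^{(1)}_ν(x)`. -/
def hankelCoeff (ν : ℝ) : ℂ :=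
  ((2 * (1 / 2) ^ ν / √Real.pi : ℝ) : ℂ) * (-Complex.I * (-2 * Complex.I) ^ ((ν - 1 / 2 : ℝ) : ℂ))

/-- Freezing `(s - 2i)^a` at `s = 0` leaves a Gamma integral, and this is exactly the subtracted
exponential. -/
theorem hankelOne_sub_eq {ν x : ℝ} (hν : 1 / 2 ≤ ν) (hx : 0 < x) :
    (√x : ℂ) * hankelOne ν x - hankelCoeff ν * Complex.exp (Complex.I * x) =
      ((2 * (1 / 2) ^ ν / √Real.pi / Real.Gamma (ν + 1 / 2) * x ^ (ν + 1 / 2) : ℝ) : ℂ) *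
      (-Complex.I * Complex.exp (Complex.I * x) * ∫ s in Ioi (0 : ℝ),
        ((s ^ (ν - 1 / 2) * Real.exp (-(x * s)) : ℝ) : ℂ) *
          (((s : ℂ) - 2 * Complex.I) ^ ((ν - 1 / 2 : ℝ) : ℂ) -
            (-2 * Complex.I) ^ ((ν - 1 / 2 : ℝ) : ℂ))) := by
  have ha : 0 ≤ ν - 1 / 2 := by linarith
  have hG : Real.Gamma (ν + 1 / 2) ≠ 0 := (Real.Gamma_pos_of_pos (by linarith)).ne'
  set a := ν - 1 / 2 with ha'
  have e1 : ν + 1 / 2 = a + 1 := by rw [ha']; ring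
  have hint1 : IntegrableOn (fun s : ℝ => ((s ^ a * Real.exp (-(x * s)) : ℝ) : ℂ) *
      ((s : ℂ) - 2 * Complex.I) ^ (a : ℂ)) (Ioi 0) := by
    have h := (poissonKernel_integrableOn ha hx (t := 1) (by simp)).const_mul
      (Complex.exp (-(Complex.I * x)))
    refine h.congr ?_
    filter_upwards [ae_restrict_mem measurableSet_Ioi] with s hs
    rw [Complex.ofReal_one, poissonKernel_one_add hs, ← mul_assoc, ← Complex.exp_add]
    simp
  have hint2 : IntegrableOn (fun s : ℝ => ((s ^ a * Real.exp (-(x * s)) : ℝ) : ℂ)) (Ioi 0) := by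
    have := integrableOn_rpow_mul_exp_neg_mul_rpow (p := 1) (s := a) (b := x) (by linarith)
      one_pos hx
    simp only [Real.rpow_one, neg_mul] at this
    exact Integrable.ofReal this
  have hval : ∫ s in Ioi (0 : ℝ), ((s ^ a * Real.exp (-(x * s)) : ℝ) : ℂ) =
      (((1 / x) ^ (a + 1) * Real.Gamma (a + 1) : ℝ) : ℂ) := by
    rw [integral_complex_ofReal, ← Real.integral_rpow_mul_exp_neg_mul_Ioi (by linarith) hx]
    simp
  have hI : ∫ s in Ioi (0 : ℝ), poissonKernel a x (1 + s * Complex.I) =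
      Complex.exp (Complex.I * x) * ∫ s in Ioi (0 : ℝ),
        ((s ^ a * Real.exp (-(x * s)) : ℝ) : ℂ) * ((s : ℂ) - 2 * Complex.I) ^ (a : ℂ) := by
    rw [← integral_const_mul]
    exact setIntegral_congr_fun measurableSet_Ioi fun s hs => poissonKernel_one_add hs
  rw [hankelOne_eq hν hx, ← ha', hI]
  simp_rw [mul_sub]
  rw [integral_sub hint1 (hint2.mul_const _), integral_mul_const, hval, hankelCoeff, ← ha', e1]
  rw [e1] at hG
  have hxp : (√x : ℝ) * (2 * (x / 2) ^ ν / (√Real.pi * Real.Gamma (a + 1))) =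
      2 * (1 / 2) ^ ν / √Real.pi / Real.Gamma (a + 1) * x ^ (a + 1) := by
    rw [Real.sqrt_eq_rpow, div_eq_mul_one_div x 2, Real.mul_rpow hx.le (by norm_num),
      show a + 1 = 1 / 2 + ν by rw [ha']; ring, Real.rpow_add hx]
    field_simp
  have hxp2 : 2 * (1 / 2) ^ ν / √Real.pi / Real.Gamma (a + 1) * x ^ (a + 1) *
      ((1 / x) ^ (a + 1) * Real.Gamma (a + 1)) = 2 * (1 / 2) ^ ν / √Real.pi := by
    rw [Real.div_rpow zero_le_one hx.le, Real.one_rpow]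
    have : x ^ (a + 1) ≠ 0 := (Real.rpow_pos_of_pos hx _).ne'
    field_simp
  have hxpC := congrArg (fun r : ℝ => (r : ℂ)) hxp
  have hxp2C := congrArg (fun r : ℝ => (r : ℂ)) hxp2
  simp only [Complex.ofReal_mul _ (2 * (x / 2) ^ ν / (√Real.pi * Real.Gamma (a + 1)))] at hxpC
  simp only [Complex.ofReal_mul _ ((1 / x) ^ (a + 1) * Real.Gamma (a + 1))] at hxp2C
  rw [← hxp2C, ← mul_assoc, hxpC]
  ring

/-- Large argument asymptotics of the first Hankel function, with an error term that vanishes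
identically for `ν = 1/2`. -/
theorem hankelOne_asymptotic {ν c : ℝ} (hν : 1 / 2 ≤ ν) (hc : 0 < c) :
    ∃ M : ℝ, 0 ≤ M ∧ (ν = 1 / 2 → M = 0) ∧ ∀ x, c ≤ x →
      ‖(√x : ℂ) * hankelOne ν x - hankelCoeff ν * Complex.exp (Complex.I * x)‖ ≤ M / x := by
  have ha : 0 ≤ ν - 1 / 2 := by linarith
  have hGp : 0 < Real.Gamma (ν + 1 / 2) := Real.Gamma_pos_of_pos (by linarith)
  have hG2 : 0 < Real.Gamma (ν - 1 / 2 + 2) := Real.Gamma_pos_of_pos (by linarith)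
  set a := ν - 1 / 2 with ha'
  set B := ((a + 1) / (c / 2)) ^ a * Real.exp (2 * (c / 2)) with hB
  have hB0 : 0 ≤ B := by positivity
  set K := 2 * (1 / 2) ^ ν / √Real.pi / Real.Gamma (ν + 1 / 2) with hK
  have hK0 : 0 ≤ K := by positivity
  -- `B` bounds `(2+s)^a e^{-cs/2}`, and `(2/x)^(a+2) Γ(a+2)` is the integral of `s^(a+1)
  -- e^{-xs/2}`. Against the prefactor `x^(a+1)` one power of `1/x` remains.
  refine ⟨K * (a * B * (2 ^ (a + 2) * Real.Gamma (a + 2))), by positivity, fun h => ?_,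
    fun x hx => ?_⟩
  · have : a = 0 := by rw [ha', h, sub_self]
    rw [this]
    simp
  have hx0 : 0 < x := hc.trans_le hx
  rw [hankelOne_sub_eq hν hx0, ← ha', ← hK]
  have hexp : ‖Complex.exp (Complex.I * x)‖ = 1 := by
    rw [mul_comm, Complex.norm_exp_ofReal_mul_I]
  rw [norm_mul, norm_mul, norm_mul, norm_neg, Complex.norm_I, hexp, one_mul, one_mul,
    Complex.norm_real, Real.norm_eq_abs, abs_of_nonneg (by positivity)]
  have hbound : ∀ s ∈ Ioi (0 : ℝ), ‖((s ^ a * Real.exp (-(x * s)) : ℝ) : ℂ) *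
      (((s : ℂ) - 2 * Complex.I) ^ (a : ℂ) - (-2 * Complex.I) ^ (a : ℂ))‖ ≤
      a * B * (s ^ (a + 2 - 1) * Real.exp (-(x / 2 * s))) := by
    intro s hs
    have hs : 0 < s := hs
    have h1 := norm_sub_two_I_cpow_sub_le ha hs.le
    have h2 := two_add_rpow_mul_exp_le ha (half_pos hc) hs.le
    have h3 : Real.exp (-(x * s)) ≤ Real.exp (-(c / 2 * s)) * Real.exp (-(x / 2 * s)) := by
      rw [← Real.exp_add]
      refine Real.exp_le_exp.2 ?_
      nlinarith
    rw [norm_mul, Complex.norm_real, Real.norm_eq_abs, abs_of_nonneg (by positivity)]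
    calc s ^ a * Real.exp (-(x * s)) * ‖((s : ℂ) - 2 * Complex.I) ^ (a : ℂ) -
          (-2 * Complex.I) ^ (a : ℂ)‖
        ≤ s ^ a * (Real.exp (-(c / 2 * s)) * Real.exp (-(x / 2 * s))) *
          (a * (2 + s) ^ a * s) := by gcongr
      _ = a * ((2 + s) ^ a * Real.exp (-(c / 2 * s))) *
          (s ^ a * s * Real.exp (-(x / 2 * s))) := by ring
      _ ≤ a * B * (s ^ a * s * Real.exp (-(x / 2 * s))) := by gcongr
      _ = _ := by
        rw [show a + 2 - 1 = a + 1 by ring, Real.rpow_add_one hs.ne']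
  have hint : IntegrableOn (fun s : ℝ => a * B * (s ^ (a + 2 - 1) * Real.exp (-(x / 2 * s))))
      (Ioi 0) := by
    have := integrableOn_rpow_mul_exp_neg_mul_rpow (p := 1) (s := a + 2 - 1) (b := x / 2)
      (by linarith) one_pos (half_pos hx0)
    simp only [Real.rpow_one, neg_mul] at this
    exact this.const_mul _
  have hI := norm_integral_le_of_norm_le hint
    (by filter_upwards [ae_restrict_mem measurableSet_Ioi] with s hs using hbound s hs)
  rw [integral_const_mul, Real.integral_rpow_mul_exp_neg_mul_Ioi (by linarith) (half_pos hx0)] at hI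
  calc K * x ^ (ν + 1 / 2) * _ ≤ K * x ^ (ν + 1 / 2) *
        (a * B * ((1 / (x / 2)) ^ (a + 2) * Real.Gamma (a + 2))) := by gcongr
    _ = _ := by
      rw [show ν + 1 / 2 = a + 2 - 1 by rw [ha']; ring, Real.rpow_sub_one hx0.ne',
        one_div_div, Real.div_rpow two_pos.le hx0.le]
      have : x ^ (a + 2) ≠ 0 := (Real.rpow_pos_of_pos hx0 _).ne'
      field_simp

theorem hankelTwo_eq_conj (ν x : ℝ) : hankelTwo ν x = starRingEnd ℂ (hankelOne ν x) := by
  simp [hankelOne, hankelTwo, sub_eq_add_neg]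

theorem hankelTwo_asymptotic {ν c : ℝ} (hν : 1 / 2 ≤ ν) (hc : 0 < c) :
    ∃ M : ℝ, 0 ≤ M ∧ (ν = 1 / 2 → M = 0) ∧ ∀ x, c ≤ x →
      ‖(√x : ℂ) * hankelTwo ν x - starRingEnd ℂ (hankelCoeff ν) *
        Complex.exp (-Complex.I * x)‖ ≤ M / x := by
  obtain ⟨M, hM0, hM1, hM⟩ := hankelOne_asymptotic hν hc
  refine ⟨M, hM0, hM1, fun x hx => ?_⟩
  rw [← RCLike.norm_conj]
  have h := hM x hx
  rw [hankelTwo_eq_conj]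
  simpa [← Complex.exp_conj] using h

theorem measurable_besselJ (ν : ℝ) : Measurable (besselJ ν) := by
  unfold besselJ
  refine Measurable.mul (by fun_prop) ?_
  simp only [intervalIntegral.integral_of_le zero_le_one]
  refine (StronglyMeasurable.integral_prod_right
    (f := fun x t : ℝ => (1 - t ^ 2) ^ (ν - 1 / 2) * Real.cos (x * t)) ?_).measurable
  exact Measurable.stronglyMeasurable (by fun_prop)

theorem measurable_besselY (ν : ℝ) : Measurable (besselY ν) := by
  unfold besselY
  refine Measurable.mul (by fun_prop) (Measurable.sub ?_ ?_)
  · simp only [intervalIntegral.integral_of_le zero_le_one]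
    refine (StronglyMeasurable.integral_prod_right
      (f := fun x t : ℝ => (1 - t ^ 2) ^ (ν - 1 / 2) * Real.sin (x * t)) ?_).measurable
    exact Measurable.stronglyMeasurable (by fun_prop)
  · refine (StronglyMeasurable.integral_prod_right
      (f := fun x t : ℝ => (1 + t ^ 2) ^ (ν - 1 / 2) * Real.exp (-(x * t))) ?_).measurable
    exact Measurable.stronglyMeasurable (by fun_prop)

theorem measurable_hankelOne (ν : ℝ) : Measurable (hankelOne ν) := by
  have h1 := measurable_besselJ ν
  have h2 := measurable_besselY ν
  unfold hankelOne
  fun_prop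

theorem measurable_hankelTwo (ν : ℝ) : Measurable (hankelTwo ν) := by
  have h1 := measurable_besselJ ν
  have h2 := measurable_besselY ν
  unfold hankelTwo
  fun_prop

/-! ### Integral transforms on the half-line. -/

theorem eLpNorm_comp_smul {E F : Type*} [NormedAddCommGroup E] [NormedSpace ℝ E]
    [MeasurableSpace E] [BorelSpace E] [FiniteDimensional ℝ E] [NormedAddCommGroup F]
    (μ : Measure E) [μ.IsAddHaarMeasure] {c : ℝ} (hc : c ≠ 0) (f : E → F) :
    eLpNorm (fun x => f (c • x)) 2 μ =
      ENNReal.ofReal |(c ^ Module.finrank ℝ E)⁻¹| ^ (1 / 2 : ℝ) * eLpNorm f 2 μ := by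
  have he : MeasurableEmbedding fun x : E => c • x := (Homeomorph.smulOfNeZero c hc).measurableEmbedding
  have h := he.eLpNorm_map_measure (g := f) (p := 2) (μ := μ)
  rw [show (fun x => f (c • x)) = f ∘ (fun x : E => c • x) from rfl, ← h,
    Measure.map_addHaar_smul μ hc, eLpNorm_smul_measure_of_ne_top (by norm_num)]
  simp

theorem ae_comp_smul {E : Type*} [NormedAddCommGroup E] [NormedSpace ℝ E]
    [MeasurableSpace E] [BorelSpace E] [FiniteDimensional ℝ E]
    (μ : Measure E) [μ.IsAddHaarMeasure] {c : ℝ} (hc : c ≠ 0) {P : E → Prop}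
    (h : ∀ᵐ x ∂μ, P x) : ∀ᵐ x ∂μ, P (c • x) := by
  have hq : Measure.QuasiMeasurePreserving (fun x : E => c • x) μ μ := by
    refine ⟨measurable_const_smul c, ?_⟩
    rw [Measure.map_addHaar_smul μ hc]
    exact Measure.smul_absolutelyContinuous
  exact hq.ae h

section HalfLine

/-- The leading part of the Hankel transform, `∫ e^{iτkr} g(k) dk`. -/
def leadingPart (τ : ℝ) (g : Lp (α := ℝ) ℂ 2 volume) (r : ℝ) : ℂ :=
  (𝓕 g : Lp (α := ℝ) ℂ 2 volume) ((-(τ / (2 * Real.pi))) • r)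

theorem measurable_leadingPart (τ : ℝ) (g : Lp (α := ℝ) ℂ 2 volume) :
    Measurable (leadingPart τ g) :=
  (Lp.stronglyMeasurable _).measurable.comp (measurable_const_smul _)

theorem leadingCoeff_ne_zero {τ : ℝ} (hτ : |τ| = 1) : -(τ / (2 * Real.pi)) ≠ 0 := by
  have : τ ≠ 0 := fun h => by simp [h] at hτ
  have := Real.pi_pos
  simp only [ne_eq, neg_eq_zero, div_eq_zero_iff, not_or]
  exact ⟨by assumption, by positivity⟩

theorem eLpNorm_leadingPart {τ : ℝ} (hτ : |τ| = 1) (g : Lp (α := ℝ) ℂ 2 volume) :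
    eLpNorm (leadingPart τ g) 2 volume = ENNReal.ofReal (2 * Real.pi) ^ (1 / 2 : ℝ) * ‖g‖ₑ := by
  unfold leadingPart
  rw [eLpNorm_comp_smul volume (leadingCoeff_ne_zero hτ), ← Lp.enorm_def]
  have hpi := Real.pi_pos
  have h1 : ‖(𝓕 g : Lp (α := ℝ) ℂ 2 volume)‖ₑ = ‖g‖ₑ := by
    rw [← ofReal_norm, ← ofReal_norm, Lp.norm_fourier_eq]
  rw [h1]
  congr 3
  rw [Module.finrank_self, pow_one, abs_inv, abs_neg, abs_div, hτ, abs_of_pos (by positivity)]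
  simp

theorem leadingPart_add {τ : ℝ} (hτ : |τ| = 1) (g h : Lp (α := ℝ) ℂ 2 volume) :
    leadingPart τ (g + h) =ᵐ[volume] leadingPart τ g + leadingPart τ h := by
  have : (𝓕 (g + h) : Lp (α := ℝ) ℂ 2 volume) = 𝓕 g + 𝓕 h := FourierTransform.fourier_add g h
  unfold leadingPart
  rw [this]
  exact ae_comp_smul volume (leadingCoeff_ne_zero hτ) (Lp.coeFn_add (𝓕 g) (𝓕 h))

theorem leadingPart_ae_eq {τ : ℝ} (hτ : |τ| = 1) (g : Lp (α := ℝ) ℂ 2 volume)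
    (hg : Integrable (g : ℝ → ℂ)) :
    leadingPart τ g =ᵐ[volume] fun r => ∫ k, Complex.exp (Complex.I * τ * (k * r : ℝ)) * g k := by
  filter_upwards [ae_comp_smul volume (leadingCoeff_ne_zero hτ) (fourier_Lp_ae_eq g hg)] with r hr
  rw [leadingPart, hr, Real.fourier_eq']
  refine integral_congr_ae (Eventually.of_forall fun k => ?_)
  simp only [smul_eq_mul]
  congr 2
  have hpi := Real.pi_pos.ne'
  have : (Real.pi : ℂ) ≠ 0 := by exact_mod_cast hpi
  simp only [RCLike.inner_apply, conj_trivial]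
  push_cast
  field_simp

/-- The remainder of the Hankel transform. -/
def remainderPart (E : ℝ → ℂ) (g : ℝ → ℂ) (r : ℝ) : ℂ := ∫ k in Ioi (0 : ℝ), E (k * r) * g k

theorem measurable_remainderPart {E g : ℝ → ℂ} (hE : Measurable E) (hg : Measurable g) :
    Measurable (remainderPart E g) := by
  refine (StronglyMeasurable.integral_prod_right
    (f := fun r k : ℝ => E (k * r) * g k) ?_).measurable
  exact Measurable.stronglyMeasurable (by fun_prop)

/-- `E(kr)` is dominated by `q(k)/r` for `r ≥ δ` and `k` in the support of `g`. -/
def Dominated (E g : ℝ → ℂ) (δ : ℝ) (q : ℝ → ℝ) : Prop :=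
  MemLp q 2 volume ∧ ∀ᵐ k ∂volume.restrict (Ioi (0 : ℝ)), g k ≠ 0 → ∀ r, δ ≤ r →
    ‖E (k * r)‖ ≤ q k / r

theorem Dominated.indicator {E g : ℝ → ℂ} {δ : ℝ} {q : ℝ → ℝ} (h : Dominated E g δ q) (W : Set ℝ) :
    Dominated E (W.indicator g) δ q := by
  refine ⟨h.1, ?_⟩
  filter_upwards [h.2] with k hk hne
  refine hk fun h0 => hne ?_
  by_cases hW : k ∈ W <;> simp [hW, h0]

theorem Dominated.integrableOn {E g : ℝ → ℂ} {δ : ℝ} {q : ℝ → ℝ} (h : Dominated E g δ q)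
    (hE : Measurable E) (hg : MemLp g 2 volume) {r : ℝ} (hr : δ ≤ r) :
    IntegrableOn (fun k => E (k * r) * g k) (Ioi 0) := by
  have hqg : Integrable (fun k => q k * ‖g k‖) := h.1.integrable_mul hg.norm
  refine Integrable.mono' (g := fun k => r⁻¹ * (q k * ‖g k‖)) (hqg.integrableOn.const_mul _) ?_ ?_
  · exact ((hE.comp (measurable_id.mul_const r)).aestronglyMeasurable.mul
      hg.aestronglyMeasurable).restrict
  · filter_upwards [h.2] with k hk
    by_cases h0 : g k = 0
    · simp [h0]
    · rw [norm_mul]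
      calc _ ≤ q k / r * ‖g k‖ := by gcongr; exact hk h0 r hr
        _ = _ := by ring

/-- Cauchy-Schwarz in `k`. The remaining factor `1/r` is square integrable on `[δ, ∞)`, which bounds
the remainder in `L²`. -/
theorem Dominated.enorm_remainderPart_le {E g : ℝ → ℂ} {δ : ℝ} {q : ℝ → ℝ}
    (h : Dominated E g δ q) (hδ : 0 < δ) (hg : MemLp g 2 volume) {r : ℝ} (hr : δ ≤ r) :
    ‖remainderPart E g r‖ₑ ≤ ‖r⁻¹‖ₑ * (eLpNorm q 2 volume * eLpNorm g 2 volume) := by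
  have hr0 : 0 < r := hδ.trans_le hr
  calc ‖remainderPart E g r‖ₑ ≤ ∫⁻ k in Ioi (0 : ℝ), ‖E (k * r) * g k‖ₑ :=
        enorm_integral_le_lintegral_enorm _
    _ ≤ ∫⁻ k in Ioi (0 : ℝ), ‖r⁻¹‖ₑ * (‖q k‖ₑ * ‖g k‖ₑ) := by
        refine lintegral_mono_ae ?_
        filter_upwards [h.2] with k hk
        by_cases h0 : g k = 0
        · simp [h0]
        · have hE : ‖E (k * r)‖ₑ ≤ ‖r⁻¹ * q k‖ₑ := by
            rw [enorm_le_iff_norm_le, norm_mul, norm_inv, Real.norm_of_nonneg hr0.le]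
            refine (hk h0 r hr).trans ?_
            rw [div_eq_inv_mul, Real.norm_eq_abs]
            gcongr
            exact le_abs_self _
          rw [enorm_mul, ← mul_assoc, ← enorm_mul r⁻¹]
          gcongr
    _ ≤ ∫⁻ k, ‖r⁻¹‖ₑ * (‖q k‖ₑ * ‖g k‖ₑ) := setLIntegral_le_lintegral _ _
    _ = ‖r⁻¹‖ₑ * ∫⁻ k, ‖q k‖ₑ * ‖g k‖ₑ := lintegral_const_mul' _ _ enorm_ne_top
    _ ≤ _ := by
        gcongr
        have := ENNReal.lintegral_mul_le_Lp_mul_Lq volume Real.HolderConjugate.two_two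
          h.1.aestronglyMeasurable.enorm hg.aestronglyMeasurable.enorm
        simpa [eLpNorm_eq_lintegral_rpow_enorm_toReal] using this

theorem eLpNorm_inv_Ici {δ : ℝ} (hδ : 0 < δ) :
    eLpNorm (fun r : ℝ => r⁻¹) 2 (volume.restrict (Ici δ)) = ENNReal.ofReal δ⁻¹ ^ (1 / 2 : ℝ) := by
  have hsq : eLpNorm (fun r : ℝ => r⁻¹) 2 (volume.restrict (Ici δ)) ^ 2 = ENNReal.ofReal δ⁻¹ := by
    rw [eLpNorm_two_sq, ← Measure.restrict_congr_set Ioi_ae_eq_Ici]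
    have h1 : ∫⁻ r in Ioi δ, ‖r⁻¹‖ₑ ^ 2 = ∫⁻ r in Ioi δ, ENNReal.ofReal (r ^ (-2 : ℝ)) := by
      refine setLIntegral_congr_fun measurableSet_Ioi fun r hr => ?_
      have hr0 : 0 < r := hδ.trans hr
      rw [← ofReal_norm, ← ENNReal.ofReal_pow (norm_nonneg _), Real.norm_eq_abs, sq_abs,
        Real.rpow_neg hr0.le, Real.rpow_two, inv_pow]
    rw [h1, ← ofReal_integral_eq_lintegral_ofReal (integrableOn_Ioi_rpow_of_lt (by norm_num) hδ),
      integral_Ioi_rpow_of_lt (by norm_num) hδ]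
    · congr 1
      norm_num
      rw [Real.rpow_neg_one]
    · filter_upwards [ae_restrict_mem measurableSet_Ioi] with r hr
      have hr0 : 0 < r := hδ.trans hr
      simp only [Pi.zero_apply]
      positivity
  rw [← hsq, ← ENNReal.rpow_natCast, ← ENNReal.rpow_mul]
  norm_num

theorem Dominated.eLpNorm_remainderPart_le {E g : ℝ → ℂ} {δ : ℝ} {q : ℝ → ℝ}
    (h : Dominated E g δ q) (hδ : 0 < δ) (hg : MemLp g 2 volume) :
    eLpNorm (remainderPart E g) 2 (volume.restrict (Ici δ)) ≤
      ENNReal.ofReal δ⁻¹ ^ (1 / 2 : ℝ) * (eLpNorm q 2 volume * eLpNorm g 2 volume) := by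
  have hfin : eLpNorm q 2 volume * eLpNorm g 2 volume ≠ ⊤ :=
    ENNReal.mul_ne_top h.1.eLpNorm_ne_top hg.eLpNorm_ne_top
  rw [← eLpNorm_inv_Ici hδ, mul_comm, ← ENNReal.ofReal_toReal hfin]
  set K := (eLpNorm q 2 volume * eLpNorm g 2 volume).toReal with hK
  have hK0 : 0 ≤ K := ENNReal.toReal_nonneg
  rw [show ENNReal.ofReal K = ‖K‖ₑ by rw [← ofReal_norm, Real.norm_of_nonneg hK0],
    ← eLpNorm_const_smul]
  refine eLpNorm_mono_enorm_ae ?_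
  filter_upwards [ae_restrict_mem measurableSet_Ici] with r hr
  refine (h.enorm_remainderPart_le hδ hg hr).trans_eq ?_
  rw [Pi.smul_apply, smul_eq_mul, enorm_mul, ← ENNReal.ofReal_toReal hfin, ← hK, mul_comm]
  congr 1
  rw [← ofReal_norm, Real.norm_of_nonneg hK0]

/-- `A ∫ e^{iτkr} g(k) dk + ∫ E(kr) g(k) dk` for `g ∈ L²`. -/
def fullTransform (A : ℂ) (τ : ℝ) (E : ℝ → ℂ) (g : ℝ → ℂ) (hg : MemLp g 2 volume) (r : ℝ) : ℂ :=
  A * leadingPart τ (hg.toLp g) r + remainderPart E g r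

theorem measurable_fullTransform (A : ℂ) (τ : ℝ) {E g : ℝ → ℂ} (hE : Measurable E)
    (hgm : Measurable g) (hg : MemLp g 2 volume) : Measurable (fullTransform A τ E g hg) :=
  ((measurable_leadingPart τ _).const_mul A).add (measurable_remainderPart hE hgm)

theorem eLpNorm_fullTransform_le (A : ℂ) {τ : ℝ} (hτ : |τ| = 1) {E g : ℝ → ℂ} (hE : Measurable E)
    (hgm : Measurable g) (hg : MemLp g 2 volume) {δ : ℝ} (hδ : 0 < δ) {q : ℝ → ℝ}
    (h : Dominated E g δ q) :
    eLpNorm (fullTransform A τ E g hg) 2 (volume.restrict (Ici δ)) ≤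
      (‖A‖ₑ * ENNReal.ofReal (2 * Real.pi) ^ (1 / 2 : ℝ) +
        ENNReal.ofReal δ⁻¹ ^ (1 / 2 : ℝ) * eLpNorm q 2 volume) * eLpNorm g 2 volume := by
  have h1 : eLpNorm (fun r => A * leadingPart τ (hg.toLp g) r) 2 (volume.restrict (Ici δ)) ≤
      ‖A‖ₑ * ENNReal.ofReal (2 * Real.pi) ^ (1 / 2 : ℝ) * eLpNorm g 2 volume := by
    refine (eLpNorm_mono_measure _ Measure.restrict_le_self).trans ?_
    have := eLpNorm_const_smul A (leadingPart τ (hg.toLp g)) 2 volume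
    rw [eLpNorm_leadingPart hτ, Lp.enorm_toLp] at this
    rw [mul_assoc, ← this]
    rfl
  refine (eLpNorm_add_le ((measurable_leadingPart τ _).const_mul A).aestronglyMeasurable
    (measurable_remainderPart hE hgm).aestronglyMeasurable (by norm_num)).trans ?_
  rw [add_mul, mul_assoc (ENNReal.ofReal δ⁻¹ ^ (1 / 2 : ℝ))]
  exact add_le_add h1 (h.eLpNorm_remainderPart_le hδ hg)

/-- The transform of `g` minus its truncation to the frequencies `a < k ≤ b` is small. -/
theorem eLpNorm_trunc_sub_fullTransform_le (A : ℂ) {τ : ℝ} (hτ : |τ| = 1) {κ E g : ℝ → ℂ}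
    (hκ : Measurable κ) (hκE : ∀ z, E z = κ z - A * Complex.exp (Complex.I * τ * z))
    (hgm : Measurable g) (hg : MemLp g 2 volume) {δ : ℝ} (hδ : 0 < δ) {q : ℝ → ℝ}
    (h : Dominated E g δ q) {a b : ℝ} (ha : 0 ≤ a) :
    eLpNorm (fun r => (∫ k in Ioc a b, κ (k * r) * g k) - fullTransform A τ E g hg r) 2
      (volume.restrict (Ici δ)) ≤
      (‖A‖ₑ * ENNReal.ofReal (2 * Real.pi) ^ (1 / 2 : ℝ) +
        ENNReal.ofReal δ⁻¹ ^ (1 / 2 : ℝ) * eLpNorm q 2 volume) *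
          eLpNorm ((Ioc a b)ᶜ.indicator g) 2 volume := by
  have hE : Measurable E := by
    rw [funext hκE]
    fun_prop
  have hg1 := hg.indicator (measurableSet_Ioc (a := a) (b := b))
  have hg2 := hg.indicator (measurableSet_Ioc (a := a) (b := b)).compl
  refine le_trans (le_of_eq ?_) (eLpNorm_fullTransform_le A hτ hE
    (hgm.indicator measurableSet_Ioc.compl) hg2 hδ (h.indicator _))
  rw [← eLpNorm_neg]
  refine eLpNorm_congr_ae ?_
  -- The part of `g` inside `(a, b]` is integrable, so its transform is the truncated integral
  -- itself; what is left is the transform of the part outside.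
  have hsum : hg.toLp g = hg1.toLp _ + hg2.toLp _ := by
    rw [← MemLp.toLp_add]
    congr 1
    exact (indicator_self_add_compl _ _).symm
  have hint : Integrable (hg1.toLp _ : ℝ → ℂ) := by
    rw [integrable_congr hg1.coeFn_toLp, integrable_indicator_iff measurableSet_Ioc]
    exact (hg.restrict _).integrable (by norm_num)
  have h1 := leadingPart_add hτ (hg1.toLp _) (hg2.toLp _)
  rw [← hsum] at h1
  filter_upwards [ae_restrict_of_ae h1, ae_restrict_of_ae (leadingPart_ae_eq hτ _ hint),
    ae_restrict_mem measurableSet_Ici] with r hr1 hr2 hr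
  have hR : remainderPart E g r = remainderPart E ((Ioc a b).indicator g) r +
      remainderPart E ((Ioc a b)ᶜ.indicator g) r := by
    unfold remainderPart
    rw [← integral_add ((h.indicator _).integrableOn hE hg1 hr)
      ((h.indicator _).integrableOn hE hg2 hr)]
    refine integral_congr_ae (Eventually.of_forall fun k => ?_)
    by_cases hk : k ∈ Ioc a b <;> simp [hk]
  have hL : leadingPart τ (hg1.toLp _) r =
      ∫ k in Ioc a b, Complex.exp (Complex.I * τ * (k * r : ℝ)) * g k := by
    rw [hr2, ← integral_indicator measurableSet_Ioc]
    refine integral_congr_ae ?_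
    filter_upwards [hg1.coeFn_toLp] with k hk
    rw [hk]
    by_cases hk : k ∈ Ioc a b <;> simp [hk]
  have hsub : Ioc a b ⊆ Ioi 0 := fun k hk => ha.trans_lt hk.1
  have hR1 : remainderPart E ((Ioc a b).indicator g) r = ∫ k in Ioc a b, E (k * r) * g k := by
    unfold remainderPart
    rw [← inter_eq_self_of_subset_right hsub, ← setIntegral_indicator measurableSet_Ioc,
      inter_eq_self_of_subset_right hsub]
    refine integral_congr_ae (Eventually.of_forall fun k => ?_)
    by_cases hk : k ∈ Ioc a b <;> simp [hk]
  have hgi : IntegrableOn g (Ioc a b) := (hg.restrict _).integrable (by norm_num)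
  have hexp : IntegrableOn (fun k => Complex.exp (Complex.I * τ * (k * r : ℝ)) * g k)
      (Ioc a b) := by
    refine Integrable.bdd_mul (c := 1) hgi (by fun_prop) (Eventually.of_forall fun k => ?_)
    rw [show Complex.I * τ * (k * r : ℝ) = ((τ * (k * r) : ℝ) : ℂ) * Complex.I by push_cast; ring,
      Complex.norm_exp_ofReal_mul_I]
  have hW : ∫ k in Ioc a b, κ (k * r) * g k =
      A * leadingPart τ (hg1.toLp _) r + remainderPart E ((Ioc a b).indicator g) r := by
    rw [hL, hR1, ← integral_const_mul, ← integral_add (hexp.const_mul A)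
      ((h.integrableOn hE hg hr).mono_set hsub)]
    refine integral_congr_ae (Eventually.of_forall fun k => ?_)
    simp only [hκE]
    ring
  simp only [Pi.neg_apply, fullTransform, hW, hR, hr1, Pi.add_apply]
  ring

end HalfLine

/-! ### The radial profile of the Fourier transform. -/

section Profile

variable {d : ℕ}

theorem nontrivial_Rd (hd : 0 < d) : Nontrivial (Rd d) := by
  have : Nonempty (Fin d) := ⟨⟨0, hd⟩⟩
  infer_instance

theorem measurable_fhat (f : L2 d) : Measurable (fhat f) :=
  ((Lp.stronglyMeasurable (𝓕 f : L2 d)).measurable.comp (measurable_const_smul _)).const_mul _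

theorem measurable_radialPart {F : Rd d → ℂ} (hF : Measurable F) : Measurable (radialPart F) := by
  unfold radialPart
  simp only [average_eq]
  refine Measurable.const_smul ?_ _
  refine (StronglyMeasurable.integral_prod_right
    (f := fun (k : ℝ) (s : Metric.sphere (0 : Rd d) 1) => F (k • (s : Rd d))) ?_).measurable
  exact (hF.comp (by fun_prop)).stronglyMeasurable

theorem radialPart_ae_eq (hd : 0 < d) {F : Rd d → ℂ} {h : ℝ → ℂ}
    (hF : F =ᵐ[volume] fun x => h ‖x‖) :
    ∀ᵐ k ∂volume.restrict (Ioi (0 : ℝ)), radialPart F k = h k := by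
  have := nontrivial_Rd hd
  have : NeZero (volume : Measure (Rd d)).toSphere := ⟨Measure.toSphere_ne_zero _⟩
  filter_upwards [ae_polar volume hF, ae_restrict_mem measurableSet_Ioi] with k hk hk0
  have hk0 : 0 < k := hk0
  have h1 : (fun s : Metric.sphere (0 : Rd d) 1 => F (k • (s : Rd d)))
      =ᵐ[(volume : Measure (Rd d)).toSphere] fun _ => h k := by
    filter_upwards [hk] with s hs
    rw [hs]
    simp [norm_smul, abs_of_pos hk0]
  rw [radialPart, average_congr h1, average_const]

/-- Converse direction to `ae_polar`: a null set of radii sweeps out a null set of points. -/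
theorem ae_norm {P : ℝ → Prop} (hd : 0 < d)
    (h : ∀ᵐ r ∂volume.restrict (Ioi (0 : ℝ)), P r) : ∀ᵐ x : Rd d, P ‖x‖ := by
  have := nontrivial_Rd hd
  set N := toMeasurable (volume.restrict (Ioi (0 : ℝ))) {r | ¬ P r} with hN
  have hNm : MeasurableSet N := measurableSet_toMeasurable _ _
  have hN0 : volume.restrict (Ioi (0 : ℝ)) N = 0 := by rw [hN, measure_toMeasurable]; exact h
  have hm : Measurable (N.indicator (1 : ℝ → ℝ≥0∞)) := measurable_one.indicator hNm
  have h0 : ∫⁻ x : Rd d, N.indicator 1 ‖x‖ = 0 := by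
    rw [lintegral_radial volume hm]
    refine mul_eq_zero_of_right _ ?_
    rw [lintegral_eq_zero_iff (by fun_prop)]
    have : ∀ᵐ r ∂volume.restrict (Ioi (0 : ℝ)), r ∉ N := measure_eq_zero_iff_ae_notMem.1 hN0
    filter_upwards [this] with r hr
    simp [hr]
  rw [lintegral_eq_zero_iff (f := fun x : Rd d => N.indicator (1 : ℝ → ℝ≥0∞) ‖x‖)
    (hm.comp measurable_norm)] at h0
  filter_upwards [h0] with x hx
  by_contra hP
  have : ‖x‖ ∈ N := subset_toMeasurable _ _ hP
  simp [this] at hx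

theorem fhat_ae_eq (hd : 0 < d) {f : L2 d} (hf : IsRadial (𝓕 f : L2 d)) :
    fhat f =ᵐ[volume] fun x => radialPart (fhat f) ‖x‖ := by
  obtain ⟨h, hh, hfh⟩ := hf
  have h2pi : (2 * Real.pi)⁻¹ ≠ 0 := by have := Real.pi_pos; positivity
  have h1 : fhat f =ᵐ[volume] fun x => (fun r =>
      (((2 * Real.pi) ^ (-((d : ℝ) / 2)) : ℝ) : ℂ) * h ((2 * Real.pi)⁻¹ * r)) ‖x‖ := by
    filter_upwards [ae_comp_smul volume h2pi hfh] with x hx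
    rw [fhat, hx, norm_smul, Real.norm_of_nonneg (by have := Real.pi_pos; positivity)]
  filter_upwards [h1, ae_norm hd (radialPart_ae_eq (h := fun r =>
      (((2 * Real.pi) ^ (-((d : ℝ) / 2)) : ℝ) : ℂ) * h ((2 * Real.pi)⁻¹ * r)) hd h1)] with x hx1 hx2
  rw [hx1, hx2]

/-- The factor `(2π)^(-d/2)` cancels the Jacobian of the rescaling by `(2π)⁻¹`. -/
theorem eLpNorm_fhat (f : L2 d) : eLpNorm (fhat f) 2 volume = ‖f‖ₑ := by
  have hpi := Real.pi_pos
  have h1 : fhat f = (((2 * Real.pi) ^ (-((d : ℝ) / 2)) : ℝ) : ℂ) •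
      fun ξ : Rd d => (𝓕 f : L2 d) ((2 * Real.pi)⁻¹ • ξ) := rfl
  have h2 : ‖(𝓕 f : L2 d)‖ₑ = ‖f‖ₑ := by
    rw [← ofReal_norm, ← ofReal_norm, Lp.norm_fourier_eq]
  rw [h1, eLpNorm_const_smul, eLpNorm_comp_smul volume (by positivity), ← Lp.enorm_def, h2,
    ← mul_assoc]
  rw [← ofReal_norm, Complex.norm_real, Real.norm_of_nonneg (by positivity),
    finrank_euclideanSpace_fin, inv_pow, inv_inv, abs_of_pos (by positivity),
    ENNReal.ofReal_rpow_of_nonneg (by positivity) (by norm_num),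
    ← ENNReal.ofReal_mul (by positivity), ← Real.rpow_natCast, ← Real.rpow_mul (by positivity),
    ← Real.rpow_add (by positivity)]
  rw [show -((d : ℝ) / 2) + d * (1 / 2) = 0 by ring]
  simp

/-- The radial profile `k^{(d-1)/2} f̂(k)` on the half-line `k > 0`. -/
def profile (f : L2 d) : ℝ → ℂ :=
  (Ioi (0 : ℝ)).indicator fun k => ((k ^ (((d : ℝ) - 1) / 2) : ℝ) : ℂ) * radialPart (fhat f) k

theorem measurable_profile (f : L2 d) : Measurable (profile f) := by
  have := measurable_radialPart (measurable_fhat f)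
  exact Measurable.indicator (by fun_prop) measurableSet_Ioi

theorem eLpNorm_profile (hd : 0 < d) {f : L2 d} (hf : IsRadial (𝓕 f : L2 d)) :
    (volume : Measure (Rd d)).toSphere univ ^ (1 / 2 : ℝ) * eLpNorm (profile f) 2 volume =
      ‖f‖ₑ := by
  have := nontrivial_Rd hd
  rw [← eLpNorm_fhat, eLpNorm_congr_ae (fhat_ae_eq hd hf)]
  have h := eLpNorm_radial (volume : Measure (Rd d))
    (measurable_radialPart (measurable_fhat f)) (measurableSet_Ioi (a := (0 : ℝ))) subset_rfl
  have h0 : (volume : Measure (Rd d)).restrict {x | ‖x‖ ∈ Ioi (0 : ℝ)} = volume := by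
    have : {x : Rd d | ‖x‖ ∈ Ioi (0 : ℝ)} = {0}ᶜ := by ext x; simp
    rw [this, restrict_compl_singleton]
  rw [h0, finrank_euclideanSpace_fin] at h
  rw [h, profile, eLpNorm_indicator_eq_eLpNorm_restrict measurableSet_Ioi]

theorem toSphere_univ_ne_zero (hd : 0 < d) : (volume : Measure (Rd d)).toSphere univ ≠ 0 := by
  have := nontrivial_Rd hd
  exact Measure.measure_univ_ne_zero.2 (Measure.toSphere_ne_zero _)

theorem memLp_profile (hd : 0 < d) {f : L2 d} (hf : IsRadial (𝓕 f : L2 d)) :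
    MemLp (profile f) 2 volume := by
  refine ⟨(measurable_profile f).aestronglyMeasurable, ?_⟩
  have h := eLpNorm_profile hd hf
  by_contra hcon
  rw [not_lt_top_iff.1 hcon, ENNReal.mul_top] at h
  · exact enorm_ne_top h.symm
  · simpa using toSphere_univ_ne_zero hd

/-- The intervals exhaust only `k > 0`; adjoining `k ≤ 0`, where the profile vanishes, makes them
exhaust the line. -/
theorem tendsto_eLpNorm_profile (hd : 0 < d) {f : L2 d} (hf : IsRadial (𝓕 f : L2 d)) :
    Tendsto (fun p : ℝ × ℝ => eLpNorm ((Ioc p.1 p.2)ᶜ.indicator (profile f)) 2 volume)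
      (𝓝[>] (0 : ℝ) ×ˢ atTop) (𝓝 0) := by
  have h := tendsto_eLpNorm_indicator_compl (memLp_profile hd hf)
    (l := 𝓝[>] (0 : ℝ) ×ˢ (atTop : Filter ℝ)) (S := fun p : ℝ × ℝ => Iic (0 : ℝ) ∪ Ioc p.1 p.2)
    (fun _ => measurableSet_Iic.union measurableSet_Ioc) (Eventually.of_forall fun k => ?_)
  · refine h.congr fun p => ?_
    congr 1
    ext k
    by_cases h0 : 0 < k
    · by_cases hk : k ∈ Ioc p.1 p.2 <;> simp [hk, h0]
    · have : profile f k = 0 := by simp [profile, h0]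
      simp [indicator, this]
  · rcases le_or_gt k (0 : ℝ) with hk | hk
    · exact Eventually.of_forall fun p => Or.inl hk
    · have h1 : ∀ᶠ a in 𝓝[>] (0 : ℝ), a < k := 
        mem_nhdsWithin_of_mem_nhds (eventually_lt_nhds hk)
      filter_upwards [h1.prod_mk (eventually_ge_atTop k)] with p hp
      exact Or.inr ⟨hp.1, hp.2⟩

/-- A factor `r^(1/2)` from `r^((2-d)/2)` and a factor `k^(1/2)` from `k^(d/2)` form `√(kr)`; the
rest is the two polar weights. -/
theorem waveTrunc_eq (H : ℝ → ℝ → ℂ) {a b : ℝ} (ha : 0 ≤ a) (hab : a ≤ b) (f : L2 d) {x : Rd d}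
    (hx : x ≠ 0) : waveTrunc H a b f x = ((‖x‖ ^ (-(((d : ℝ) - 1) / 2)) : ℝ) : ℂ) * (1 / 2 *
      ∫ k in Ioc a b, ((√(k * ‖x‖) : ℂ) * H (((d : ℝ) - 2) / 2) (k * ‖x‖)) * profile f k) := by
  have hr : 0 < ‖x‖ := norm_pos_iff.2 hx
  rw [waveTrunc, intervalIntegral.integral_of_le hab,
    mul_left_comm ((‖x‖ ^ (-(((d : ℝ) - 1) / 2)) : ℝ) : ℂ),
    ← integral_const_mul ((‖x‖ ^ (-(((d : ℝ) - 1) / 2)) : ℝ) : ℂ)]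
  refine congrArg (fun z : ℂ => 1 / 2 * z) ?_
  refine setIntegral_congr_fun measurableSet_Ioc fun k hk => ?_
  have hk0 : 0 < k := ha.trans_lt hk.1
  simp only [profile, indicator_of_mem (show k ∈ Ioi (0 : ℝ) from hk0)]
  have e : ‖x‖ ^ ((2 - (d : ℝ)) / 2) * k ^ ((d : ℝ) / 2) =
      ‖x‖ ^ (-(((d : ℝ) - 1) / 2)) * (√(k * ‖x‖) * k ^ (((d : ℝ) - 1) / 2)) := by
    rw [Real.sqrt_mul hk0.le, Real.sqrt_eq_rpow, Real.sqrt_eq_rpow,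
      show (2 - (d : ℝ)) / 2 = -(((d : ℝ) - 1) / 2) + 1 / 2 by ring, Real.rpow_add hr,
      show (d : ℝ) / 2 = 1 / 2 + ((d : ℝ) - 1) / 2 by ring, Real.rpow_add hk0]
    ring_nf
  have eC := congrArg (fun r : ℝ => (r : ℂ)) e
  simp only [Complex.ofReal_mul] at eC
  linear_combination (H (((d : ℝ) - 2) / 2) (k * ‖x‖) * radialPart (fhat f) k) * eC

/-- The `L²` norm outside a ball of a function `r^{-(d-1)/2} w(r)`. -/
theorem eLpNorm_rpow_mul_radial (hd : 0 < d) {w : ℝ → ℂ} (hw : Measurable w) {δ : ℝ} (hδ : 0 < δ) :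
    eLpNorm (fun x : Rd d => ((‖x‖ ^ (-(((d : ℝ) - 1) / 2)) : ℝ) : ℂ) * (1 / 2 * w ‖x‖)) 2
      (volume.restrict {x | δ ≤ ‖x‖}) ≤ (volume : Measure (Rd d)).toSphere univ ^ (1 / 2 : ℝ) *
        eLpNorm w 2 (volume.restrict (Ici δ)) := by
  have := nontrivial_Rd hd
  have h := eLpNorm_radial (volume : Measure (Rd d))
    (w := fun r => ((r ^ (-(((d : ℝ) - 1) / 2)) : ℝ) : ℂ) * (1 / 2 * w r)) (by fun_prop)
    (measurableSet_Ici (a := δ)) (fun r hr => hδ.trans_le hr)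
  rw [finrank_euclideanSpace_fin] at h
  refine h.trans_le ?_
  gcongr
  refine eLpNorm_mono_ae ?_
  filter_upwards [ae_restrict_mem measurableSet_Ici] with r hr
  have hr0 : 0 < r := hδ.trans_le hr
  rw [← mul_assoc, ← Complex.ofReal_mul, ← Real.rpow_add hr0, add_neg_cancel, Real.rpow_zero,
    Complex.ofReal_one, one_mul, norm_mul]
  norm_num
  linarith [norm_nonneg (w r)]

/-- Existence of, and bounds for, the projection onto waves with kernel `H`, when `√z H(z)` is
`A e^{iτz}` up to an error dominated on the frequency support of `f`. -/
theorem exists_isWaveProj (hd : 0 < d) {H : ℝ → ℝ → ℂ} (hH : Measurable (H (((d : ℝ) - 2) / 2)))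
    (A : ℂ) {τ : ℝ} (hτ : |τ| = 1) {f : L2 d} (hf : IsRadial (𝓕 f : L2 d)) {E : ℝ → ℂ}
    (hE : ∀ z, E z = (√z : ℂ) * H (((d : ℝ) - 2) / 2) z - A * Complex.exp (Complex.I * τ * z))
    (hdom : ∀ δ, 0 < δ → ∃ q, Dominated E (profile f) δ q) :
    ∃ u, IsWaveProj H f u ∧ ∀ δ q, 0 < δ → Dominated E (profile f) δ q →
      eLpNorm u 2 (volume.restrict {x | δ ≤ ‖x‖}) ≤
        (‖A‖ₑ * ENNReal.ofReal (2 * Real.pi) ^ (1 / 2 : ℝ) +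
          ENNReal.ofReal δ⁻¹ ^ (1 / 2 : ℝ) * eLpNorm q 2 volume) * ‖f‖ₑ := by
  have hg := memLp_profile hd hf
  have hgm := measurable_profile f
  have hκ : Measurable fun z : ℝ => (√z : ℂ) * H (((d : ℝ) - 2) / 2) z := by fun_prop
  have hEm : Measurable E := by
    rw [funext hE]
    fun_prop
  set S := fullTransform A τ E (profile f) hg with hS
  have hSm : Measurable S := measurable_fullTransform A τ hEm hgm hg
  refine ⟨fun x => ((‖x‖ ^ (-(((d : ℝ) - 1) / 2)) : ℝ) : ℂ) * (1 / 2 * S ‖x‖), ⟨?_, ?_⟩, ?_⟩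
  · exact Measurable.aestronglyMeasurable (by fun_prop)
  · intro δ R hδ _
    obtain ⟨q, hq⟩ := hdom δ hδ
    set K := (volume : Measure (Rd d)).toSphere univ ^ (1 / 2 : ℝ) *
      (‖A‖ₑ * ENNReal.ofReal (2 * Real.pi) ^ (1 / 2 : ℝ) +
        ENNReal.ofReal δ⁻¹ ^ (1 / 2 : ℝ) * eLpNorm q 2 volume) with hK
    have hKtop : K ≠ ⊤ := by
      refine ENNReal.mul_ne_top (ENNReal.rpow_ne_top_of_nonneg (by norm_num) (measure_ne_top _ _))
        (ENNReal.add_ne_top.2 ⟨ENNReal.mul_ne_top enorm_ne_top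
          (ENNReal.rpow_ne_top_of_nonneg (by norm_num) ENNReal.ofReal_ne_top),
          ENNReal.mul_ne_top (ENNReal.rpow_ne_top_of_nonneg (by norm_num) ENNReal.ofReal_ne_top)
            hq.1.eLpNorm_ne_top⟩)
    have hlim := ENNReal.Tendsto.const_mul (a := K) (tendsto_eLpNorm_profile hd hf) (Or.inr hKtop)
    rw [mul_zero] at hlim
    -- The error is at most `K` times the `L²` norm of the profile outside `(a, b]`, even on all of
    -- `|x| ≥ δ`; the outer radius `R` plays no role.
    refine tendsto_of_tendsto_of_tendsto_of_le_of_le' tendsto_const_nhds hlim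
      (Eventually.of_forall fun _ => zero_le) ?_
    have h01 : ∀ᶠ a in 𝓝[>] (0 : ℝ), 0 < a ∧ a < 1 :=
      (eventually_mem_nhdsWithin).and (mem_nhdsWithin_of_mem_nhds (Iio_mem_nhds one_pos))
    filter_upwards [h01.prod_mk (eventually_ge_atTop (1 : ℝ))] with p hp
    obtain ⟨⟨ha, ha1⟩, hb⟩ := hp
    have hw : Measurable fun r => (∫ k in Ioc p.1 p.2, ((√(k * r) : ℂ) *
        H (((d : ℝ) - 2) / 2) (k * r)) * profile f k) - S r := by
      refine Measurable.sub ?_ hSm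
      refine (StronglyMeasurable.integral_prod_right (f := fun r k : ℝ => ((√(k * r) : ℂ) *
        H (((d : ℝ) - 2) / 2) (k * r)) * profile f k) ?_).measurable
      refine Measurable.stronglyMeasurable ?_
      exact (hκ.comp (measurable_snd.mul measurable_fst)).mul (hgm.comp measurable_snd)
    have hsub : {x : Rd d | δ ≤ ‖x‖ ∧ ‖x‖ ≤ R} ⊆ {x | δ ≤ ‖x‖} := fun x hx => hx.1
    calc _ ≤ eLpNorm (fun x => waveTrunc H p.1 p.2 f x -
            ((‖x‖ ^ (-(((d : ℝ) - 1) / 2)) : ℝ) : ℂ) * (1 / 2 * S ‖x‖)) 2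
            (volume.restrict {x | δ ≤ ‖x‖}) :=
          eLpNorm_mono_measure _ (Measure.restrict_mono_set _ hsub)
      _ = eLpNorm (fun x : Rd d => ((‖x‖ ^ (-(((d : ℝ) - 1) / 2)) : ℝ) : ℂ) * (1 / 2 *
            (fun r => (∫ k in Ioc p.1 p.2, ((√(k * r) : ℂ) *
              H (((d : ℝ) - 2) / 2) (k * r)) * profile f k) - S r) ‖x‖)) 2
            (volume.restrict {x | δ ≤ ‖x‖}) := by
          refine eLpNorm_congr_ae ?_
          filter_upwards [ae_restrict_mem (measurableSet_le measurable_const measurable_norm)]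
            with x hx
          have hx0 : x ≠ 0 := norm_pos_iff.1 (hδ.trans_le hx)
          rw [waveTrunc_eq H ha.le (ha1.le.trans hb) f hx0]
          ring
      _ ≤ _ := eLpNorm_rpow_mul_radial hd hw hδ
      _ ≤ _ := by
          rw [hK, mul_assoc]
          gcongr
          exact eLpNorm_trunc_sub_fullTransform_le A hτ hκ hE hgm hg hδ hq ha.le
  · intro δ q hδ hq
    refine (eLpNorm_rpow_mul_radial hd hSm hδ).trans ?_
    rw [← eLpNorm_profile hd hf, mul_left_comm]
    gcongr
    exact eLpNorm_fullTransform_le A hτ hEm hgm hg hδ hq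

end Profile

/-! ### Existence and bounds for the wave projections. -/

variable {d : ℕ}

/-- `√z H_{(d-2)/2}(z) = A e^{iτz} + O(1/z)`, without error term in dimension three. -/
structure HasWaveAsymptotic (d : ℕ) (H : ℝ → ℝ → ℂ) (A : ℂ) (τ : ℝ) : Prop where
  measurable : Measurable (H (((d : ℝ) - 2) / 2))
  abs_eq_one : |τ| = 1
  bound : ∀ c, 0 < c → ∃ M : ℝ, 0 ≤ M ∧ (d = 3 → M = 0) ∧ ∀ z, c ≤ z →
    ‖(√z : ℂ) * H (((d : ℝ) - 2) / 2) z - A * Complex.exp (Complex.I * τ * z)‖ ≤ M / z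

theorem order_eq_half (h : d = 3) : ((d : ℝ) - 2) / 2 = 1 / 2 := by
  subst h; norm_num

theorem half_le_order (hd : 3 ≤ d) : 1 / 2 ≤ ((d : ℝ) - 2) / 2 := by
  have hd' : (3 : ℝ) ≤ d := by exact_mod_cast hd
  linarith

theorem hasWaveAsymptotic_hankelOne (hd : 3 ≤ d) :
    HasWaveAsymptotic d hankelOne (hankelCoeff (((d : ℝ) - 2) / 2)) 1 := by
  refine ⟨measurable_hankelOne _, abs_one, fun c hc => ?_⟩
  obtain ⟨M, h0, h1, h2⟩ := hankelOne_asymptotic (half_le_order hd) hc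
  exact ⟨M, h0, fun h => h1 (order_eq_half h), fun z hz => by simpa using h2 z hz⟩

theorem hasWaveAsymptotic_hankelTwo (hd : 3 ≤ d) :
    HasWaveAsymptotic d hankelTwo (starRingEnd ℂ (hankelCoeff (((d : ℝ) - 2) / 2))) (-1) := by
  refine ⟨measurable_hankelTwo _, by simp, fun c hc => ?_⟩
  obtain ⟨M, h0, h1, h2⟩ := hankelTwo_asymptotic (half_le_order hd) hc
  exact ⟨M, h0, fun h => h1 (order_eq_half h), fun z hz => by simpa using h2 z hz⟩

section Kernel

variable {H : ℝ → ℝ → ℂ} {A : ℂ} {τ : ℝ} (hH : HasWaveAsymptotic d H A τ)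
include hH

/-- For fixed `r > 0` the argument `kr` stays above `ar`, where the asymptotics bound the kernel. -/
theorem HasWaveAsymptotic.integrableOn (hd : 0 < d) {f : L2 d} (hf : IsRadial (𝓕 f : L2 d))
    {a b r : ℝ} (ha : 0 < a) (hr : 0 < r) :
    IntegrableOn (fun k => ((√(k * r) : ℂ) * H (((d : ℝ) - 2) / 2) (k * r)) * profile f k)
      (Ioc a b) := by
  have hgi : IntegrableOn (profile f) (Ioc a b) :=
    ((memLp_profile hd hf).restrict _).integrable (by norm_num)
  obtain ⟨M, hM0, -, hM⟩ := hH.bound (a * r) (by positivity)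
  have hm := hH.measurable
  refine Integrable.bdd_mul (c := ‖A‖ + M / (a * r)) hgi
    (Measurable.aestronglyMeasurable (by fun_prop)) ?_
  filter_upwards [ae_restrict_mem measurableSet_Ioc] with k hk
  have hkr : a * r ≤ k * r := by have := hk.1.le; gcongr
  have h1 := hM _ hkr
  have h2 : ‖A * Complex.exp (Complex.I * τ * (k * r : ℝ))‖ = ‖A‖ := by
    rw [norm_mul, show Complex.I * τ * (k * r : ℝ) = ((τ * (k * r) : ℝ) : ℂ) * Complex.I by
      push_cast; ring, Complex.norm_exp_ofReal_mul_I, mul_one]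
  have h3 : M / (k * r) ≤ M / (a * r) := by gcongr
  have h4 := norm_le_norm_add_norm_sub' ((√(k * r) : ℂ) * H (((d : ℝ) - 2) / 2) (k * r))
    (A * Complex.exp (Complex.I * τ * (k * r : ℝ)))
  rw [h2] at h4
  linarith

omit hH in
theorem aestronglyMeasurable_waveTrunc (hH : Measurable (H (((d : ℝ) - 2) / 2))) (a b : ℝ)
    (f : L2 d) : AEStronglyMeasurable (waveTrunc H a b f) volume := by
  unfold waveTrunc
  have hF := measurable_radialPart (measurable_fhat f)
  have hm : ∀ s : Set ℝ, Measurable fun x : Rd d => ∫ k in s,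
      ((‖x‖ ^ ((2 - (d : ℝ)) / 2) : ℝ) : ℂ) * H (((d : ℝ) - 2) / 2) (k * ‖x‖) *
      radialPart (fhat f) k * ((k ^ ((d : ℝ) / 2) : ℝ) : ℂ) := fun s => by
    refine (StronglyMeasurable.integral_prod_right (f := fun (x : Rd d) (k : ℝ) =>
      ((‖x‖ ^ ((2 - (d : ℝ)) / 2) : ℝ) : ℂ) * H (((d : ℝ) - 2) / 2) (k * ‖x‖) *
      radialPart (fhat f) k * ((k ^ ((d : ℝ) / 2) : ℝ) : ℂ)) ?_).measurable
    exact Measurable.stronglyMeasurable (by fun_prop)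
  unfold intervalIntegral
  exact (((hm _).sub (hm _)).const_mul _).aestronglyMeasurable

/-- `P⁺ f` and `P⁻ f` exist if the Fourier transform of `f` vanishes near the origin. -/
theorem HasWaveAsymptotic.exists_isWaveProj_of_gap (hd : 0 < d) {f : L2 d}
    (hf : IsRadial (𝓕 f : L2 d)) {α : ℝ} (hα : 0 < α)
    (hgap : ∀ᵐ k ∂volume.restrict (Ioi (0 : ℝ)), profile f k ≠ 0 → α ≤ k) :
    ∃ u, IsWaveProj H f u ∧ ∀ δ M, 0 < δ →
      (∀ z, α * δ ≤ z → ‖(√z : ℂ) * H (((d : ℝ) - 2) / 2) z -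
        A * Complex.exp (Complex.I * τ * z)‖ ≤ M / z) →
      eLpNorm u 2 (volume.restrict {x | δ ≤ ‖x‖}) ≤
        (‖A‖ₑ * ENNReal.ofReal (2 * Real.pi) ^ (1 / 2 : ℝ) +
          ‖M‖ₑ * ENNReal.ofReal (α * δ)⁻¹ ^ (1 / 2 : ℝ)) * ‖f‖ₑ := by
  -- The gap makes the majorant `M/k` square integrable, with norm `|M| α^(-1/2)`.
  set q : ℝ → ℝ → ℝ := fun M => (Ici α).indicator fun k => M * k⁻¹ with hq
  have hqn : ∀ M, eLpNorm (q M) 2 volume = ‖M‖ₑ * ENNReal.ofReal α⁻¹ ^ (1 / 2 : ℝ) := fun M => by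
    rw [hq, eLpNorm_indicator_eq_eLpNorm_restrict measurableSet_Ici, ← eLpNorm_inv_Ici hα,
      ← eLpNorm_const_smul]
    rfl
  have hdom : ∀ δ M, 0 < δ → (∀ z, α * δ ≤ z → ‖(√z : ℂ) * H (((d : ℝ) - 2) / 2) z -
        A * Complex.exp (Complex.I * τ * z)‖ ≤ M / z) →
      Dominated (fun z : ℝ => (√z : ℂ) * H (((d : ℝ) - 2) / 2) z -
        A * Complex.exp (Complex.I * τ * z)) (profile f) δ (q M) := by
    intro δ M hδ hM
    refine ⟨⟨Measurable.aestronglyMeasurable ?_, ?_⟩, ?_⟩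
    · exact Measurable.indicator (by fun_prop) measurableSet_Ici
    · rw [hqn]
      exact ENNReal.mul_lt_top enorm_lt_top
        (ENNReal.rpow_lt_top_of_nonneg (by norm_num) ENNReal.ofReal_ne_top)
    · filter_upwards [hgap] with k hk hne r hr
      have hαk := hk hne
      refine (hM (k * r) (mul_le_mul hαk hr hδ.le (hα.le.trans hαk))).trans_eq ?_
      rw [hq]
      simp only [indicator_of_mem (show k ∈ Ici α from hαk)]
      rw [← div_eq_mul_inv, div_div]
  obtain ⟨u, hu, hbound⟩ := exists_isWaveProj hd hH.measurable A hH.abs_eq_one hf (fun z => rfl)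
    (fun δ hδ => by
      obtain ⟨M, -, -, hM⟩ := hH.bound (α * δ) (by positivity)
      exact ⟨q M, hdom δ M hδ hM⟩)
  refine ⟨u, hu, fun δ M hδ hM => (hbound δ (q M) hδ (hdom δ M hδ hM)).trans_eq ?_⟩
  have e : ENNReal.ofReal (α * δ)⁻¹ ^ (1 / 2 : ℝ) =
      ENNReal.ofReal α⁻¹ ^ (1 / 2 : ℝ) * ENNReal.ofReal δ⁻¹ ^ (1 / 2 : ℝ) := by
    rw [mul_inv, ENNReal.ofReal_mul (by positivity), ENNReal.mul_rpow_of_nonneg _ _ (by norm_num)]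
  rw [hqn, e]
  ring

/-- The constant `M` is zero for every threshold, so the remainder kernel vanishes on `z > 0` and
the majorant `q = 0` works without a gap. -/
theorem HasWaveAsymptotic.exists_isWaveProj_three (hd : d = 3) {f : L2 d}
    (hf : IsRadial (𝓕 f : L2 d)) : ∃ u, IsWaveProj H f u := by
  obtain ⟨u, hu, -⟩ := exists_isWaveProj (by omega) hH.measurable A hH.abs_eq_one hf (fun z => rfl)
    (fun δ hδ => ⟨fun _ => 0, MemLp.zero', by
      filter_upwards [ae_restrict_mem measurableSet_Ioi] with k hk _ r hr
      have hk : 0 < k := hk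
      have hr0 : 0 < r := hδ.trans_le hr
      obtain ⟨M, -, h3, hM⟩ := hH.bound (k * r) (by positivity)
      simpa [h3 hd] using hM (k * r) le_rfl⟩)
  exact ⟨u, hu⟩

end Kernel

/-! ### The sum of the two projections. -/

/-- A spectral gap of `f` is seen by its profile. -/
theorem profile_gap (hd : 0 < d) {f : L2 d} (hf : IsRadial (𝓕 f : L2 d)) {α : ℝ}
    (h : ∀ᵐ ζ : Rd d, 2 * Real.pi * ‖ζ‖ < α → (𝓕 f : L2 d) ζ = 0) :
    ∀ᵐ k ∂volume.restrict (Ioi (0 : ℝ)), profile f k ≠ 0 → α ≤ k := by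
  have hpi := Real.pi_pos
  have h1 : fhat f =ᵐ[volume] fun x => (Ici α).indicator (radialPart (fhat f)) ‖x‖ := by
    filter_upwards [fhat_ae_eq hd hf,
      ae_comp_smul volume (c := (2 * Real.pi)⁻¹) (by positivity) h] with x hx hx2
    by_cases hα : α ≤ ‖x‖
    · rw [indicator_of_mem (show ‖x‖ ∈ Ici α from hα), hx]
    · rw [indicator_of_notMem (show ‖x‖ ∉ Ici α from hα), fhat, hx2, mul_zero]
      rw [norm_smul, Real.norm_of_nonneg (by positivity), ← mul_assoc,
        mul_inv_cancel₀ (by positivity), one_mul]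
      exact not_le.1 hα
  filter_upwards [radialPart_ae_eq hd h1] with k hk hne
  by_contra hα
  refine hne ?_
  rw [indicator_of_notMem (show k ∉ Ici α from hα)] at hk
  simp [profile, indicator, hk]

theorem fourier_ae_eq_radialPart (hd : 0 < d) {f : L2 d} (hf : IsRadial (𝓕 f : L2 d)) :
    ((𝓕 f : L2 d) : Rd d → ℂ) =ᵐ[volume] fun ζ => (((2 * Real.pi) ^ ((d : ℝ) / 2) : ℝ) : ℂ) *
      radialPart (fhat f) (2 * Real.pi * ‖ζ‖) := by
  have hpi := Real.pi_pos
  filter_upwards [ae_comp_smul volume (c := 2 * Real.pi) (by positivity) (fhat_ae_eq hd hf)]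
    with ζ hζ
  rw [norm_smul, Real.norm_of_nonneg (by positivity)] at hζ
  rw [← hζ, fhat, smul_smul, inv_mul_cancel₀ (by positivity), one_smul, ← mul_assoc,
    ← Complex.ofReal_mul, ← Real.rpow_add (by positivity), add_neg_cancel, Real.rpow_zero,
    Complex.ofReal_one, one_mul]

/-- The inverse Fourier transform of a frequency truncation is a Bessel integral. -/
theorem fourierInv_normCut_ae_eq (hd : 3 ≤ d) {f : L2 d} (hf : IsRadial (𝓕 f : L2 d)) {a b : ℝ}
    (ha : 0 < a) :
    ((𝓕⁻ (normCut (Ioc (a / (2 * Real.pi)) (b / (2 * Real.pi))) measurableSet_Ioc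
      (𝓕 f : L2 d)) : L2 d) : Rd d → ℂ) =ᵐ[volume] fun x =>
      ((‖x‖ ^ (-(((d : ℝ) - 1) / 2)) : ℝ) : ℂ) * ∫ k in Ioc a b,
        ((√(k * ‖x‖) * besselJ (((d : ℝ) - 2) / 2) (k * ‖x‖) : ℝ) : ℂ) * profile f k := by
  have hd0 : 0 < d := by omega
  have := nontrivial_Rd hd0
  have hpi := Real.pi_pos
  set S := Ioc (a / (2 * Real.pi)) (b / (2 * Real.pi)) with hS
  have hSm : MeasurableSet S := measurableSet_Ioc
  have hSmem : ∀ s, s ∈ S ↔ 2 * Real.pi * s ∈ Ioc a b := fun s => by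
    rw [hS, mem_Ioc, mem_Ioc, div_lt_iff₀ (by positivity), le_div_iff₀ (by positivity),
      mul_comm s]
  set G := normCut S measurableSet_Ioc (𝓕 f : L2 d) with hG
  have hGi : Integrable (G : Rd d → ℂ) := integrable_normCut _ (fun s hs => hs.2) _
  have hGr : IsRadial G := hf.normCut _
  have hGae : (G : Rd d → ℂ) =ᵐ[volume] fun ζ => S.indicator (fun s =>
      (((2 * Real.pi) ^ ((d : ℝ) / 2) : ℝ) : ℂ) * radialPart (fhat f) (2 * Real.pi * s)) ‖ζ‖ := by
    filter_upwards [normCut_ae_eq hSm (𝓕 f : L2 d), fourier_ae_eq_radialPart hd0 hf] with ζ h1 h2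
    rw [hG, h1]
    by_cases h : ‖ζ‖ ∈ S <;> simp [h, h2]
  have h0 : ∀ᵐ x : Rd d, x ≠ 0 := Measure.ae_ne volume 0
  filter_upwards [fourierInv_Lp_ae_eq G hGi, h0] with x hx hx0
  have hr : 0 < ‖x‖ := norm_pos_iff.2 hx0
  set r := ‖x‖ with hr'
  set i : Fin d := ⟨0, hd0⟩
  set e : Rd d := EuclideanSpace.single i (1 : ℝ) with he
  have hen : ‖e‖ = 1 := by simp [he]
  obtain ⟨p, -, hp⟩ := exists_eq_norm_of_invariant (continuous_fourier hGi) hGr.fourier_invariant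
  -- By rotation invariance `x` may be moved to a coordinate axis, where the phase involves a single
  -- coordinate as in `sphere_integral_exp`.
  have hrot : 𝓕⁻ (G : Rd d → ℂ) x = 𝓕⁻ (G : Rd d → ℂ) (r • e) := by
    rw [Real.fourierInv_eq_fourier_neg, Real.fourierInv_eq_fourier_neg, hp, hp, norm_neg, norm_neg,
      norm_smul, hen, mul_one, Real.norm_of_nonneg hr.le]
  rw [hx, hrot, Real.fourierInv_eq']
  set W : Rd d → ℂ := fun ζ => Complex.exp (Complex.I * (2 * Real.pi * r * ζ i : ℝ)) *
    S.indicator (fun s => (((2 * Real.pi) ^ ((d : ℝ) / 2) : ℝ) : ℂ) *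
      radialPart (fhat f) (2 * Real.pi * s)) ‖ζ‖ with hW
  have hWae : (fun ζ : Rd d => Complex.exp (((2 * Real.pi * inner ℝ ζ (r • e) : ℝ) : ℂ) *
      Complex.I) • G ζ) =ᵐ[volume] W := by
    filter_upwards [hGae] with ζ hζ
    have hinner : inner ℝ ζ (r • e) = r * ζ i := by
      rw [real_inner_smul_right, he, EuclideanSpace.inner_single_right]
      simp
    rw [hW, hζ, hinner, smul_eq_mul]
    congr 2
    push_cast
    ring
  have hWi : Integrable W := by
    rw [← integrable_congr hWae]
    refine Integrable.bdd_mul (c := 1) hGi (by fun_prop) (Eventually.of_forall fun ζ => ?_)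
    rw [Complex.norm_exp_ofReal_mul_I]
  rw [integral_congr_ae hWae, integral_polar volume hWi, finrank_euclideanSpace_fin]
  have hsub : Ioc a b ⊆ Ioi 0 := fun k hk => ha.trans hk.1
  set φ : ℝ → ℂ := (Ioc a b).indicator fun k =>
    ((√(k * r) * besselJ (((d : ℝ) - 2) / 2) (k * r) : ℝ) : ℂ) * profile f k with hφ
  have hR : ∫ k in Ioc a b, ((√(k * r) * besselJ (((d : ℝ) - 2) / 2) (k * r) : ℝ) : ℂ) *
      profile f k = ((2 * Real.pi : ℝ) : ℂ) * ∫ s in Ioi (0 : ℝ), φ (2 * Real.pi * s) := by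
    rw [integral_comp_mul_left_Ioi φ 0 (by positivity), mul_zero, Complex.real_smul, ← mul_assoc,
      ← Complex.ofReal_mul, mul_inv_cancel₀ (by positivity), Complex.ofReal_one, one_mul, hφ,
      setIntegral_indicator measurableSet_Ioc, inter_eq_self_of_subset_right hsub]
  rw [hR, ← mul_assoc, ← integral_const_mul]
  refine setIntegral_congr_fun measurableSet_Ioi fun s hs => ?_
  have hs : 0 < s := hs
  by_cases hsS : s ∈ S
  · have hk : 2 * Real.pi * s ∈ Ioc a b := (hSmem s).1 hsS
    have hW2 : ∀ θ : Metric.sphere (0 : Rd d) 1, W (s • (θ : Rd d)) =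
        Complex.exp (Complex.I * ((2 * Real.pi * s * r) * (θ : Rd d) i : ℝ)) *
          ((((2 * Real.pi) ^ ((d : ℝ) / 2) : ℝ) : ℂ) * radialPart (fhat f) (2 * Real.pi * s)) := by
      intro θ
      have hn : ‖s • (θ : Rd d)‖ = s := by simp [norm_smul, abs_of_pos hs]
      simp only [hW, hn, indicator_of_mem hsS, PiLp.smul_apply, smul_eq_mul]
      congr 4
      ring
    simp only [hW2]
    rw [integral_mul_const, sphere_integral_exp hd i (by positivity), hφ, indicator_of_mem hk,
      profile, indicator_of_mem (show 2 * Real.pi * s ∈ Ioi (0 : ℝ) from hsub hk),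
      Complex.real_smul]
    set k := 2 * Real.pi * s with hk'
    have hk0 : 0 < k := by positivity
    -- The powers to be matched are the polar density in `s = k/(2π)`, the constants of the sphere
    -- integral, and the normalisation of `fhat`.
    have key : s ^ (d - 1) * ((2 * Real.pi) ^ ((d : ℝ) / 2) * (k * r) ^ (-(((d : ℝ) - 2) / 2))) *
        (2 * Real.pi) ^ ((d : ℝ) / 2) =
        r ^ (-(((d : ℝ) - 1) / 2)) * (2 * Real.pi) * √(k * r) * k ^ (((d : ℝ) - 1) / 2) := by
      have e1 : s = k * (2 * Real.pi)⁻¹ := by rw [hk']; field_simp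
      have e2 : s ^ (d - 1) = k ^ ((d : ℝ) - 1) * (2 * Real.pi) ^ (1 - (d : ℝ)) := by
        rw [← Real.rpow_natCast, Nat.cast_sub (by omega), Nat.cast_one, e1,
          Real.mul_rpow hk0.le (by positivity), Real.inv_rpow (by positivity),
          ← Real.rpow_neg (by positivity), neg_sub]
      have e3 : (2 * Real.pi) ^ (1 - (d : ℝ)) * (2 * Real.pi) ^ ((d : ℝ) / 2) *
          (2 * Real.pi) ^ ((d : ℝ) / 2) = 2 * Real.pi := by
        rw [← Real.rpow_add (by positivity), ← Real.rpow_add (by positivity)]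
        rw [show 1 - (d : ℝ) + d / 2 + d / 2 = 1 by ring, Real.rpow_one]
      have e4 : k ^ ((d : ℝ) - 1) * k ^ (-(((d : ℝ) - 2) / 2)) =
          k ^ (1 / 2 : ℝ) * k ^ (((d : ℝ) - 1) / 2) := by
        rw [← Real.rpow_add hk0, ← Real.rpow_add hk0]
        congr 1
        ring
      have e5 : r ^ (-(((d : ℝ) - 2) / 2)) = r ^ (-(((d : ℝ) - 1) / 2)) * r ^ (1 / 2 : ℝ) := by
        rw [← Real.rpow_add hr]
        congr 1
        ring
      rw [e2, Real.mul_rpow hk0.le hr.le, Real.sqrt_mul hk0.le, Real.sqrt_eq_rpow,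
        Real.sqrt_eq_rpow, e5]
      calc _ = (k ^ ((d : ℝ) - 1) * k ^ (-(((d : ℝ) - 2) / 2))) *
            ((2 * Real.pi) ^ (1 - (d : ℝ)) * (2 * Real.pi) ^ ((d : ℝ) / 2) *
              (2 * Real.pi) ^ ((d : ℝ) / 2)) *
            (r ^ (-(((d : ℝ) - 1) / 2)) * r ^ (1 / 2 : ℝ)) := by ring
        _ = _ := by rw [e3, e4]; ring
    have keyC := congrArg (fun t : ℝ => (t : ℂ)) key
    simp only [Complex.ofReal_mul] at keyC ⊢
    linear_combination ((besselJ (((d : ℝ) - 2) / 2) (k * r) : ℂ) * radialPart (fhat f) k) * keyC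
  · have hk : 2 * Real.pi * s ∉ Ioc a b := fun h => hsS ((hSmem s).2 h)
    have hW2 : ∀ θ : Metric.sphere (0 : Rd d) 1, W (s • (θ : Rd d)) = 0 := by
      intro θ
      have hn : ‖s • (θ : Rd d)‖ = s := by simp [norm_smul, abs_of_pos hs]
      simp only [hW, hn, indicator_of_notMem hsS, mul_zero]
    simp only [hW2, hφ, indicator_of_notMem hk, integral_zero, smul_zero, mul_zero]

/-- The `Y` terms cancel in `H^{(1)} + H^{(2)} = 2J`, and the `2` cancels the `½`. -/
theorem waveTrunc_add_ae_eq (hd : 3 ≤ d) {f : L2 d} (hf : IsRadial (𝓕 f : L2 d)) {a b : ℝ}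
    (ha : 0 < a) (hab : a ≤ b) :
    (fun x => waveTrunc hankelOne a b f x + waveTrunc hankelTwo a b f x) =ᵐ[volume]
      (𝓕⁻ (normCut (Ioc (a / (2 * Real.pi)) (b / (2 * Real.pi))) measurableSet_Ioc
        (𝓕 f : L2 d)) : L2 d) := by
  have hd0 : 0 < d := by omega
  have := nontrivial_Rd hd0
  have h0 : ∀ᵐ x : Rd d, x ≠ 0 := Measure.ae_ne volume 0
  filter_upwards [fourierInv_normCut_ae_eq hd hf (b := b) ha, h0] with x hx hx0
  have hr : 0 < ‖x‖ := norm_pos_iff.2 hx0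
  rw [hx, waveTrunc_eq _ ha.le hab f hx0, waveTrunc_eq _ ha.le hab f hx0, ← mul_add, ← mul_add,
    ← integral_add ((hasWaveAsymptotic_hankelOne hd).integrableOn hd0 hf ha hr)
      ((hasWaveAsymptotic_hankelTwo hd).integrableOn hd0 hf ha hr), ← integral_const_mul]
  congr 2
  ext k
  simp only [hankelOne, hankelTwo]
  push_cast
  ring

theorem eventually_pos_le : ∀ᶠ p : ℝ × ℝ in 𝓝[>] (0 : ℝ) ×ˢ atTop, 0 < p.1 ∧ p.1 ≤ p.2 := by
  have h01 : ∀ᶠ a in 𝓝[>] (0 : ℝ), 0 < a ∧ a < 1 :=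
    (eventually_mem_nhdsWithin).and (mem_nhdsWithin_of_mem_nhds (Iio_mem_nhds one_pos))
  filter_upwards [h01.prod_mk (eventually_ge_atTop (1 : ℝ))] with p hp
  exact ⟨hp.1.1, hp.1.2.le.trans hp.2⟩

/-- The sum of the truncated outgoing and incoming projections converges to the identity. -/
theorem tendsto_waveTrunc_add (hd : 3 ≤ d) {f : L2 d} (hf : IsRadial f) :
    Tendsto (fun p : ℝ × ℝ => eLpNorm (fun x => waveTrunc hankelOne p.1 p.2 f x +
      waveTrunc hankelTwo p.1 p.2 f x - f x) 2 volume) (𝓝[>] (0 : ℝ) ×ˢ atTop) (𝓝 0) := by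
  have := nontrivial_Rd (d := d) (by omega)
  have hpi := Real.pi_pos
  have hcut := tendsto_normCut (l := 𝓝[>] (0 : ℝ) ×ˢ (atTop : Filter ℝ))
    (S := fun p : ℝ × ℝ => Ioc (p.1 / (2 * Real.pi)) (p.2 / (2 * Real.pi)))
    (fun _ => measurableSet_Ioc) (𝓕 f : L2 d) ?_
  · have hcont : Continuous fun g : L2 d => (𝓕⁻ g : L2 d) :=
      (Lp.fourierTransformₗᵢ (Rd d) ℂ).symm.continuous
    have h1 := (hcont.tendsto _).comp hcut
    rw [FourierTransform.fourierInv_fourier_eq, tendsto_iff_edist_tendsto_0] at h1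
    refine h1.congr' ?_
    filter_upwards [eventually_pos_le] with p hp
    rw [Function.comp, edist_eq_enorm_sub, Lp.enorm_def]
    refine eLpNorm_congr_ae ?_
    filter_upwards [waveTrunc_add_ae_eq hd hf.fourier hp.1 hp.2, Lp.coeFn_sub
      (𝓕⁻ (normCut (Ioc (p.1 / (2 * Real.pi)) (p.2 / (2 * Real.pi))) measurableSet_Ioc
        (𝓕 f : L2 d)) : L2 d) f] with x h2 h3
    rw [h3, Pi.sub_apply, ← h2]
  · have h0 : ∀ᵐ x : Rd d, x ≠ 0 := Measure.ae_ne volume 0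
    filter_upwards [h0] with x hx
    have hr : 0 < 2 * Real.pi * ‖x‖ := by have := norm_pos_iff.2 hx; positivity
    have h1 : ∀ᶠ a in 𝓝[>] (0 : ℝ), a < 2 * Real.pi * ‖x‖ :=
      mem_nhdsWithin_of_mem_nhds (eventually_lt_nhds hr)
    filter_upwards [h1.prod_mk (eventually_ge_atTop (2 * Real.pi * ‖x‖))] with p hp
    refine ⟨?_, ?_⟩
    · rw [div_lt_iff₀ (by positivity), mul_comm]; exact hp.1
    · rw [le_div_iff₀ (by positivity), mul_comm]; exact hp.2

/-! ### Outgoing and incoming parts determine each other. -/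

theorem ae_eq_of_tendsto_eLpNorm {α ι : Type*} [MeasurableSpace α] {μ : Measure α}
    {l : Filter ι} [l.NeBot] {w : ι → α → ℂ} {u v : α → ℂ}
    (hw : ∀ i, AEStronglyMeasurable (w i) μ) (hum : AEStronglyMeasurable u μ)
    (hvm : AEStronglyMeasurable v μ)
    (hu : Tendsto (fun i => eLpNorm (fun x => w i x - u x) 2 μ) l (𝓝 0))
    (hv : Tendsto (fun i => eLpNorm (fun x => w i x - v x) 2 μ) l (𝓝 0)) : u =ᵐ[μ] v := by
  have hlim := hv.add hu
  rw [add_zero] at hlim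
  have hle : eLpNorm (u - v) 2 μ ≤ 0 := by
    refine ge_of_tendsto' hlim fun i => ?_
    have e : u - v = (fun x => w i x - v x) - fun x => w i x - u x := by
      ext x
      simp
    rw [e]
    exact eLpNorm_sub_le ((hw i).sub hvm) ((hw i).sub hum) (by norm_num)
  have h0 := (eLpNorm_eq_zero_iff (hum.sub hvm) (by norm_num)).1 (le_antisymm hle zero_le)
  filter_upwards [h0] with x hx
  exact sub_eq_zero.1 hx

section Complement

variable {H H' : ℝ → ℝ → ℂ} (hH : Measurable (H (((d : ℝ) - 2) / 2)))
  (hH' : Measurable (H' (((d : ℝ) - 2) / 2))) {f : L2 d}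
  (h : Tendsto (fun p : ℝ × ℝ => eLpNorm (fun x => waveTrunc H p.1 p.2 f x +
      waveTrunc H' p.1 p.2 f x - f x) 2 volume) (𝓝[>] (0 : ℝ) ×ˢ atTop) (𝓝 0))
include hH hH' h

/-- With truncations `w` and `w'`, write `w' - (f - u) = (w + w' - f) - (w - u)`; both terms tend to
zero on each annulus. -/
theorem IsWaveProj.complement {u : Rd d → ℂ} (hu : IsWaveProj H f u) :
    IsWaveProj H' f (fun x => f x - u x) := by
  have hfm := Lp.aestronglyMeasurable f
  refine ⟨hfm.sub hu.1, fun δ R hδ hR => ?_⟩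
  have hlim := h.add (hu.2 δ R hδ hR)
  rw [add_zero] at hlim
  refine tendsto_of_tendsto_of_tendsto_of_le_of_le tendsto_const_nhds hlim (fun _ => zero_le)
    fun p => ?_
  have hw := aestronglyMeasurable_waveTrunc hH p.1 p.2 f
  have hw' := aestronglyMeasurable_waveTrunc hH' p.1 p.2 f
  have e : (fun x => waveTrunc H' p.1 p.2 f x - (f x - u x)) =
      (fun x => waveTrunc H p.1 p.2 f x + waveTrunc H' p.1 p.2 f x - f x) -
        fun x => waveTrunc H p.1 p.2 f x - u x := by
    ext x
    simp only [Pi.sub_apply]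
    ring
  simp only
  rw [e]
  refine (eLpNorm_sub_le ((hw.add hw').sub hfm).restrict (hw.sub hu.1).restrict
    (by norm_num)).trans ?_
  exact add_le_add (eLpNorm_mono_measure _ Measure.restrict_le_self) le_rfl

theorem IsWaveProj.add_ae_eq (hd : 0 < d) {u v : Rd d → ℂ} (hu : IsWaveProj H f u)
    (hv : IsWaveProj H' f v) : u + v =ᵐ[volume] f := by
  have := nontrivial_Rd hd
  have hu' := hu.complement hH hH' h
  -- Limits are unique on each annulus, and countably many annuli cover `x ≠ 0`. The shift by `2`
  -- keeps the inner radius strictly below the outer one at `n = 0`.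
  have hann : ∀ n : ℕ, ∀ᵐ x : Rd d, (1 / ((n : ℝ) + 2) ≤ ‖x‖ ∧ ‖x‖ ≤ n + 2) →
      (u + v) x = f x := by
    intro n
    have hn : (0 : ℝ) ≤ n := n.cast_nonneg
    have hδ : 0 < 1 / ((n : ℝ) + 2) := by positivity
    have hδR : 1 / ((n : ℝ) + 2) < n + 2 := by
      rw [div_lt_iff₀ (by positivity)]
      nlinarith
    set s := {x : Rd d | 1 / ((n : ℝ) + 2) ≤ ‖x‖ ∧ ‖x‖ ≤ n + 2} with hs
    have hsm : MeasurableSet s :=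
      (measurableSet_le measurable_const measurable_norm).inter
        (measurableSet_le measurable_norm measurable_const)
    have h0 := ae_eq_of_tendsto_eLpNorm (w := fun p : ℝ × ℝ => waveTrunc H' p.1 p.2 f)
      (u := fun x => f x - u x) (v := v)
      (fun p => (aestronglyMeasurable_waveTrunc hH' p.1 p.2 f).restrict)
      hu'.1.restrict hv.1.restrict (hu'.2 _ _ hδ hδR) (hv.2 _ _ hδ hδR)
    filter_upwards [(ae_restrict_iff' hsm).1 h0] with x hx hxs
    have hx' := hx hxs
    rw [Pi.add_apply, ← hx']
    ring
  have h0 : ∀ᵐ x : Rd d, x ≠ 0 := Measure.ae_ne volume 0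
  filter_upwards [ae_all_iff.2 hann, h0] with x hx hx0
  have hr : 0 < ‖x‖ := norm_pos_iff.2 hx0
  obtain ⟨m, hm⟩ := exists_nat_gt (max ‖x‖ (1 / ‖x‖))
  have hm1 := (le_max_left _ _).trans_lt hm
  have hm2 := (le_max_right _ _).trans_lt hm
  refine hx m ⟨?_, by linarith⟩
  rw [div_lt_iff₀ hr] at hm2
  rw [div_le_iff₀ (by positivity)]
  nlinarith

end Complement

/-! ### Density of the domain. -/

/-- Radial functions whose Fourier transform vanishes near the origin are dense. -/
theorem exists_gap_approx (hd : 0 < d) {f : L2 d} (hf : IsRadial f) {ε : ℝ} (hε : 0 < ε) :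
    ∃ g : L2 d, IsRadial g ∧ ‖f - g‖ < ε ∧ ∃ α, 0 < α ∧
      ∀ᵐ k ∂volume.restrict (Ioi (0 : ℝ)), profile g k ≠ 0 → α ≤ k := by
  have := nontrivial_Rd hd
  have hpi := Real.pi_pos
  -- The approximants are obtained by deleting the frequencies `|ζ| < η` and letting `η → 0`.
  have hcut := tendsto_normCut (l := 𝓝[>] (0 : ℝ)) (S := fun η => Ici η)
    (fun _ => measurableSet_Ici) (𝓕 f : L2 d) ?_
  · have hcont : Continuous fun g : L2 d => (𝓕⁻ g : L2 d) :=
      (Lp.fourierTransformₗᵢ (Rd d) ℂ).symm.continuous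
    have h1 := (hcont.tendsto _).comp hcut
    rw [FourierTransform.fourierInv_fourier_eq] at h1
    have h2 := h1.eventually (Metric.ball_mem_nhds f hε)
    obtain ⟨η, hη, hη0⟩ := (h2.and eventually_mem_nhdsWithin).exists
    have hη0 : 0 < η := hη0
    have hF : (𝓕 (𝓕⁻ (normCut (Ici η) measurableSet_Ici (𝓕 f : L2 d)) : L2 d) : L2 d) =
        normCut (Ici η) measurableSet_Ici (𝓕 f : L2 d) := FourierTransform.fourier_fourierInv_eq _
    have hrad : IsRadial (normCut (Ici η) measurableSet_Ici (𝓕 f : L2 d)) := hf.fourier.normCut _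
    refine ⟨𝓕⁻ (normCut (Ici η) measurableSet_Ici (𝓕 f : L2 d)), hrad.fourierInv, ?_,
      2 * Real.pi * η, by positivity, profile_gap hd (by rw [hF]; exact hrad) ?_⟩
    · rw [← dist_eq_norm, dist_comm]
      exact hη
    · rw [hF]
      filter_upwards [normCut_ae_eq measurableSet_Ici (𝓕 f : L2 d)] with ζ hζ hlt
      rw [hζ]
      refine indicator_of_notMem ?_ _
      have : ‖ζ‖ < η := by nlinarith
      simpa using this
  · have h0 : ∀ᵐ x : Rd d, x ≠ 0 := Measure.ae_ne volume 0
    filter_upwards [h0] with x hx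
    have hr : 0 < ‖x‖ := norm_pos_iff.2 hx
    exact mem_nhdsWithin_of_mem_nhds ((eventually_lt_nhds hr).mono fun η h => h.le)

/-! ### Littlewood-Paley operators. -/

section LittlewoodPaley

variable (Φ : LPCutoff d)

theorem LPCutoff.exists_bound : ∃ C : ℝ≥0, ∀ x, ‖(((1 - Φ.φ x : ℝ)) : ℂ)‖ ≤ C := by
  have hc : HasCompactSupport Φ.φ :=
    HasCompactSupport.intro (isCompact_closedBall (0 : Rd d) (11 / 10)) (fun x hx => by
      by_contra h
      exact hx (Φ.support_subset h))
  obtain ⟨C, hC⟩ := Φ.smooth.continuous.bounded_above_of_compact_support hc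
  have hC0 : 0 ≤ C := (norm_nonneg _).trans (hC 0)
  refine ⟨⟨1 + C, by positivity⟩, fun x => ?_⟩
  rw [Complex.norm_real]
  refine (norm_sub_le _ _).trans ?_
  rw [norm_one]
  change 1 + ‖Φ.φ x‖ ≤ 1 + C
  gcongr
  exact hC x

theorem fourier_LPgt_ae_eq (N : ℝ) (f : L2 d) :
    ((𝓕 (LPgt Φ N f) : L2 d) : Rd d → ℂ) =ᵐ[volume] fun ζ =>
      ((1 - Φ.φ ((2 * Real.pi / N) • ζ) : ℝ) : ℂ) * (𝓕 f : L2 d) ζ := by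
  rw [LPgt, FourierTransform.fourier_fourierInv_eq]
  exact MemLp.coeFn_toLp _

theorem isRadial_fourier_LPgt (hd : 0 < d) (N : ℝ) {f : L2 d} (hf : IsRadial f) :
    IsRadial (𝓕 (LPgt Φ N f) : L2 d) := by
  have := nontrivial_Rd hd
  obtain ⟨h, hh, hfh⟩ := hf.fourier
  obtain ⟨e, he⟩ := exists_norm_eq (Rd d) (zero_le_one' ℝ)
  have hc := Φ.smooth.continuous
  refine ⟨fun r => ((1 - Φ.φ ((2 * Real.pi / N) • (r • e)) : ℝ) : ℂ) * h r, ?_, ?_⟩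
  · refine Measurable.mul (Continuous.measurable (by fun_prop)) hh
  · filter_upwards [fourier_LPgt_ae_eq Φ N f, hfh] with ζ h1 h2
    rw [h1, h2, Φ.radial ((2 * Real.pi / N) • ζ) ((2 * Real.pi / N) • (‖ζ‖ • e))
      (by simp [norm_smul, he])]

theorem profile_LPgt_gap (hd : 0 < d) {N : ℝ} (hN : 0 < N) {f : L2 d} (hf : IsRadial f) :
    ∀ᵐ k ∂volume.restrict (Ioi (0 : ℝ)), profile (LPgt Φ N f) k ≠ 0 → N ≤ k := by
  have hpi := Real.pi_pos
  refine profile_gap hd (isRadial_fourier_LPgt Φ hd N hf) ?_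
  filter_upwards [fourier_LPgt_ae_eq Φ N f] with ζ h1 hlt
  rw [h1, Φ.eq_one]
  · simp
  · rw [norm_smul, Real.norm_of_nonneg (by positivity), div_mul_eq_mul_div, div_le_one hN]
    exact hlt.le

/-- Plancherel; rescaling the symbol by `N` does not change its supremum, so `C` is uniform in `N`.
-/
theorem enorm_LPgt_le {C : ℝ≥0} (hC : ∀ x, ‖(((1 - Φ.φ x : ℝ)) : ℂ)‖ ≤ C) (N : ℝ) (f : L2 d) :
    ‖LPgt Φ N f‖ₑ ≤ C * ‖f‖ₑ := by
  have h2 : ∀ g : L2 d, ‖g‖ₑ = ‖(𝓕 g : L2 d)‖ₑ := fun g => by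
    rw [← ofReal_norm, ← ofReal_norm, Lp.norm_fourier_eq]
  rw [h2 (LPgt Φ N f), h2 f, Lp.enorm_def, Lp.enorm_def, ← smul_eq_mul, ← ENNReal.smul_def]
  refine eLpNorm_le_nnreal_smul_eLpNorm_of_ae_le_mul ?_ 2
  filter_upwards [fourier_LPgt_ae_eq Φ N f] with ζ h1
  rw [h1, nnnorm_mul]
  gcongr
  exact hC _

end LittlewoodPaley

theorem HasWaveAsymptotic.exists_LP_bound {H : ℝ → ℝ → ℂ} {A : ℂ} {τ : ℝ}
    (hH : HasWaveAsymptotic d H A τ) (hd : 0 < d) (Φ : LPCutoff d) :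
    ∃ C : ℝ≥0, ∀ N : ℝ, 0 < N → ∀ f : L2 d, IsRadial f →
      ∀ g : L2 d, g = LPge Φ N f ∨ g = LPgt Φ N f → ∃ u, IsWaveProj H g u ∧
        eLpNorm u 2 (volume.restrict {x : Rd d | 1 / 100 * N⁻¹ ≤ ‖x‖}) ≤ C * ‖f‖ₑ := by
  obtain ⟨C, hC⟩ := Φ.exists_bound
  obtain ⟨M, -, -, hM⟩ := hH.bound (1 / 200) (by norm_num)
  set K : ℝ≥0∞ := ‖A‖ₑ * ENNReal.ofReal (2 * Real.pi) ^ (1 / 2 : ℝ) +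
    ‖M‖ₑ * ENNReal.ofReal (1 / 200 : ℝ)⁻¹ ^ (1 / 2 : ℝ) with hK
  have hKtop : K ≠ ⊤ := ENNReal.add_ne_top.2 ⟨ENNReal.mul_ne_top enorm_ne_top
    (ENNReal.rpow_ne_top_of_nonneg (by norm_num) ENNReal.ofReal_ne_top),
    ENNReal.mul_ne_top enorm_ne_top
      (ENNReal.rpow_ne_top_of_nonneg (by norm_num) ENNReal.ofReal_ne_top)⟩
  refine ⟨K.toNNReal * C, fun N hN f hf g hg => ?_⟩
  -- Both operators are `LPgt` at a scale `N' ≥ N/2`, so both have a gap below `N/2`. With `δ =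
  -- 1/(100 N)` the threshold is `N/2 · δ = 1/200`, which is where `M` was taken.
  obtain ⟨N', hN', rfl⟩ : ∃ N', N / 2 ≤ N' ∧ g = LPgt Φ N' f := by
    rcases hg with rfl | rfl
    · exact ⟨N / 2, le_rfl, rfl⟩
    · exact ⟨N, by linarith, rfl⟩
  have hN'0 : 0 < N' := (half_pos hN).trans_le hN'
  obtain ⟨u, hu, hb⟩ := hH.exists_isWaveProj_of_gap hd (isRadial_fourier_LPgt Φ hd N' hf)
    (half_pos hN) ((profile_LPgt_gap Φ hd hN'0 hf).mono fun k hk hne => hN'.trans (hk hne))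
  refine ⟨u, hu, ?_⟩
  have e : N / 2 * (1 / 100 * N⁻¹) = 1 / 200 := by field_simp; norm_num
  have := hb (1 / 100 * N⁻¹) M (by positivity) (by rw [e]; exact hM)
  rw [e, ← hK] at this
  refine this.trans ?_
  rw [ENNReal.coe_mul, ENNReal.coe_toNNReal hKtop, mul_assoc]
  gcongr
  exact enorm_LPgt_le Φ hC N' f

end InOut

end

/-! ### The theorem. -/

theorem lemma4p2 (d : ℕ) (hd : 3 ≤ d) :
    -- (i) `P⁺ + P⁻` acts as the identity on `L²_rad`:
    -- the frequency-truncated sums converge to `f` for every radial `f`,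
    ((∀ f : InOut.L2 d, InOut.IsRadial f →
        Tendsto (fun p : ℝ × ℝ => eLpNorm (fun x =>
            InOut.waveTrunc InOut.hankelOne p.1 p.2 f x +
              InOut.waveTrunc InOut.hankelTwo p.1 p.2 f x - f x) 2 volume)
          (𝓝[>] (0 : ℝ) ×ˢ atTop) (𝓝 0)) ∧
      -- `P⁺ f` and `P⁻ f` are defined for the same `f`, and their sum is `f`,
      (∀ f : InOut.L2 d, InOut.IsRadial f →
        ((∃ u, InOut.IsOutgoing f u) ↔ ∃ v, InOut.IsIncoming f v) ∧
        ∀ u v, InOut.IsOutgoing f u → InOut.IsIncoming f v → u + v =ᵐ[volume] f) ∧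
      -- and this covers a dense subspace of `L²_rad`, which is everything if `d = 3`.
      (∀ f : InOut.L2 d, InOut.IsRadial f → ∀ ε : ℝ, 0 < ε →
        ∃ g : InOut.L2 d, InOut.IsRadial g ∧ ‖f - g‖ < ε ∧
          (∃ u, InOut.IsOutgoing g u) ∧ ∃ v, InOut.IsIncoming g v) ∧
      (d = 3 → ∀ f : InOut.L2 d, InOut.IsRadial f →
        (∃ u, InOut.IsOutgoing f u) ∧ ∃ v, InOut.IsIncoming f v)) ∧
    -- (ii) `P^± P_{≥N}` and `P^± P_{>N}` are bounded from `L²_rad` to `L²(|x| ≥ N⁻¹/100)`,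
    -- uniformly in `N`.
    (∀ Φ : InOut.LPCutoff d, ∃ C : ℝ≥0, ∀ N : ℝ, 0 < N →
      ∀ f : InOut.L2 d, InOut.IsRadial f →
      ∀ g : InOut.L2 d, g = InOut.LPge Φ N f ∨ g = InOut.LPgt Φ N f →
        ∃ u v : InOut.Rd d → ℂ, InOut.IsOutgoing g u ∧ InOut.IsIncoming g v ∧
          eLpNorm u 2 (volume.restrict {x : InOut.Rd d | 1 / 100 * N⁻¹ ≤ ‖x‖}) ≤ C * ‖f‖ₑ ∧
          eLpNorm v 2 (volume.restrict {x : InOut.Rd d | 1 / 100 * N⁻¹ ≤ ‖x‖}) ≤ C * ‖f‖ₑ) := by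
  have hd0 : 0 < d := by omega
  have h1 := InOut.hasWaveAsymptotic_hankelOne hd
  have h2 := InOut.hasWaveAsymptotic_hankelTwo hd
  refine ⟨⟨fun f hf => InOut.tendsto_waveTrunc_add hd hf, fun f hf => ?_, fun f hf ε hε => ?_,
    fun h3 f hf => ?_⟩, fun Φ => ?_⟩
  · have hlim := InOut.tendsto_waveTrunc_add hd hf
    have hlim' := hlim
    -- The converse implication uses the same complement argument with the two kernels exchanged.
    simp_rw [add_comm (InOut.waveTrunc InOut.hankelOne _ _ f _)] at hlim'
    refine ⟨⟨fun ⟨u, hu⟩ => ⟨_, hu.complement h1.measurable h2.measurable hlim⟩,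
      fun ⟨v, hv⟩ => ⟨_, hv.complement h2.measurable h1.measurable hlim'⟩⟩,
      fun u v hu hv => hu.add_ae_eq h1.measurable h2.measurable hlim hd0 hv⟩
  · obtain ⟨g, hg, hfg, α, hα, hgap⟩ := InOut.exists_gap_approx hd0 hf hε
    obtain ⟨u, hu, -⟩ := h1.exists_isWaveProj_of_gap hd0 hg.fourier hα hgap
    obtain ⟨v, hv, -⟩ := h2.exists_isWaveProj_of_gap hd0 hg.fourier hα hgap
    exact ⟨g, hg, hfg, ⟨u, hu⟩, v, hv⟩
  · exact ⟨h1.exists_isWaveProj_three h3 hf.fourier, h2.exists_isWaveProj_three h3 hf.fourier⟩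
  · obtain ⟨C₁, hC₁⟩ := h1.exists_LP_bound hd0 Φ
    obtain ⟨C₂, hC₂⟩ := h2.exists_LP_bound hd0 Φ
    refine ⟨max C₁ C₂, fun N hN f hf g hg => ?_⟩
    obtain ⟨u, hu, hub⟩ := hC₁ N hN f hf g hg
    obtain ⟨v, hv, hvb⟩ := hC₂ N hN f hf g hg
    refine ⟨u, v, hu, hv, hub.trans ?_, hvb.trans ?_⟩
    · gcongr
      exact le_max_left _ _
    · gcongr
      exact le_max_right _ _
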